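/- Setting. Let $n_1,n_2\ge 1$, let $S_1,S_2$ be disjoint sets of $n_1$ and $n_2$ nodes (of type 1 and type 2), $n=n_1+n_2$, and let $0\le k_1\le k_2$ be integers. A network consists of two disjoint sets $\mathcal E_P$ (protected links) and $\mathcal E_{NP}$ (non-protected links) of unordered pairs of distinct nodes of $S_1\cup S_2$. It is $(k_1,k_2)$-resistant if, for every $\mathcal E_A\subseteq\mathcal E_{NP}$: (a) if $|\mathcal E_A|\le k_1$, any two nodes are joined by a path in $(S_1\cup S_2,\ \mathcal E_P\cup(\mathcal E_{NP}\setminus\mathcal E_A))$; and (b) if $|\mathcal E_A|\le k_2$, any two nodes of $S_2$ are joined by a path in that same graph. Let $c_P\ge c_{NP}>0$. A network is optimal if it minimizes the cost $c_P|\mathcal E_P|+c_{NP}|\mathcal E_{NP}|$ among all $(k_1,k_2)$-resistant networks. An $s^D_p$ is a $(k_1,k_2)$-resistant network with exactly $p$ protected links and, among those, the minimum number of non-protected links; "$s^D_p$ is optimal" means that such networks exist and each of them is optimal. Corollary 3 (with Corollary 2). Assume $n_1\ge k_1+1$, $n_2\ge k_2-k_1+1$, $n_2\frac{k_1+1}{2}\le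 n_1$, $k_1$ odd and $n_2(k_2+1)$ even. Then the condition of Regime I, $1+k_1-n(k_2-k_1)\le 0$, holds if and only if $k_2>k_1$, and the condition of Regime II, $1+k_1-n(k_2-k_1)>0$, holds if and only if $k_1=k_2$. Moreover: I) If $k_2>k_1$, put $T_1=k_1+1+\frac{k_1+1}{n_1}$ and $T_2=k_2+1+\frac{k_2-k_1}{n_2-1}$. Then $2<T_1<T_2$ (so that each of the following cases occurs for some cost ratio), and (1) if $2\frac{c_P}{c_{NP}}\ge T_2$, then $s^D_0$ is optimal; (2) if $T_1\le 2\frac{c_P}{c_{NP}}<T_2$, then $s^D_{n_2-1}$ is optimal; (3) if $2\frac{c_P}{c_{NP}}<T_1$, then $s^D_{n-1}$ is optimal. Every optimal network is an $s^D_0$, an $s^D_{n_2-1}$ or an $s^D_{n-1}$. II) If $k_1=k_2$, then $n_2\ge\frac{1+k_1}{1+k_1-n_1(k_2-k_1)}$. Put $T=\frac{n_1(k_1+1)+n_2(k_2+1)}{n_1+n_2-1}$. Then $T>2$ (so that both of the following cases occur for some cost ratio), and (i) if $2\frac{c_P}{c_{NP}}\ge T$, then $s^D_0$ is optimal; (ii)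 if $2\frac{c_P}{c_{NP}}<T$, then $s^D_{n-1}$ is optimal. Every optimal network is an $s^D_0$ or an $s^D_{n-1}$, and if $n_2\ge 2$, no $s^D_{n_2-1}$ is optimal. -/

import Mathlib

namespace IoT

/-- The devices of the two-layer network: `n₁` nodes of type 1 (left summand) and
`n₂` nodes of type 2 (right summand). -/
abbrev Node (n₁ n₂ : ℕ) : Type := Fin n₁ ⊕ Fin n₂

/-- A network design: disjoint sets of protected and of non-protected links, where a link is an
unordered pair of distinct nodes. -/
structure Design (n₁ n₂ : ℕ) where
  /-- the protected links -/
  EP : Finset (Sym2 (Node n₁ n₂))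
  /-- the non-protected links -/
  ENP : Finset (Sym2 (Node n₁ n₂))
  disjoint : Disjoint EP ENP
  not_isDiag_EP : ∀ e ∈ EP, ¬ e.IsDiag
  not_isDiag_ENP : ∀ e ∈ ENP, ¬ e.IsDiag

variable {n₁ n₂ : ℕ}

/-- The network that is left after the links of `EA` have been removed from the non-protected
links. -/
def Design.afterAttack (g : Design n₁ n₂) (EA : Finset (Sym2 (Node n₁ n₂))) :
    SimpleGraph (Node n₁ n₂) :=
  SimpleGraph.fromEdgeSet (((g.EP ∪ (g.ENP \ EA) : Finset (Sym2 (Node n₁ n₂)))) :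
    Set (Sym2 (Node n₁ n₂)))

/-- `(k₁, k₂)`-resistance: all nodes remain mutually attainable after the removal of any at most
`k₁` non-protected links, and the nodes of type 2 remain mutually attainable (through paths of the
whole network) after the removal of any at most `k₂` non-protected links. -/
def Design.IsResistant (k₁ k₂ : ℕ) (g : Design n₁ n₂) : Prop :=
  (∀ EA ⊆ g.ENP, EA.card ≤ k₁ → ∀ i j : Node n₁ n₂, (g.afterAttack EA).Reachable i j) ∧
  (∀ EA ⊆ g.ENP, EA.card ≤ k₂ →
    ∀ i j : Fin n₂, (g.afterAttack EA).Reachable (Sum.inr i) (Sum.inr j))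

/-- The cost of a design, for unit costs `cP` of protected and `cNP` of non-protected links. -/
def Design.cost (cP cNP : ℝ) (g : Design n₁ n₂) : ℝ :=
  cP * (g.EP.card : ℝ) + cNP * (g.ENP.card : ℝ)

/-- Optimal designs: the `(k₁, k₂)`-resistant networks of minimal cost. -/
def Design.IsOptimal (k₁ k₂ : ℕ) (cP cNP : ℝ) (g : Design n₁ n₂) : Prop :=
  g.IsResistant k₁ k₂ ∧
    ∀ g' : Design n₁ n₂, g'.IsResistant k₁ k₂ → g.cost cP cNP ≤ g'.cost cP cNP

/-- `g` is an `s^D_p`: a `(k₁, k₂)`-resistant network with `p` protected links and the minimum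
number of non-protected links among those. -/
def Design.IsSD (k₁ k₂ p : ℕ) (g : Design n₁ n₂) : Prop :=
  g.IsResistant k₁ k₂ ∧ g.EP.card = p ∧
    ∀ g' : Design n₁ n₂, g'.IsResistant k₁ k₂ → g'.EP.card = p → g.ENP.card ≤ g'.ENP.card

/-- "The `s^D_p` are optimal strategies": such networks exist, and each of them is optimal. -/
def SDOptimal (n₁ n₂ k₁ k₂ : ℕ) (cP cNP : ℝ) (p : ℕ) : Prop :=
  (∃ g : Design n₁ n₂, g.IsSD k₁ k₂ p) ∧
    ∀ g : Design n₁ n₂, g.IsSD k₁ k₂ p → g.IsOptimal k₁ k₂ cP cNP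

/-- The defining inequality of Regime I. -/
def RegimeI (n₁ n₂ k₁ k₂ : ℕ) : Prop :=
  1 + (k₁ : ℝ) - ((n₁ : ℝ) + n₂) * ((k₂ : ℝ) - k₁) ≤ 0

/-- The defining inequality of Regime II. -/
def RegimeII (n₁ n₂ k₁ k₂ : ℕ) : Prop :=
  0 < 1 + (k₁ : ℝ) - ((n₁ : ℝ) + n₂) * ((k₂ : ℝ) - k₁)

end IoT

/-! Resistance is a statement about cuts: a proper cut crossed by no protected link needs `k₁ + 1`
non-protected links, and `k₂ + 1` if it separates two nodes of type 2 (`isResistant_iff_cut`). Merge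
nodes along protected links and let `c₁`, `c₂` count the resulting classes without and with nodes of
type 2. At least `n - c₁ - c₂` links are protected, and summing the cuts around all classes bounds
twice the number of non-protected links from below (`Design.IsResistant.exists_bounds`).

With `r = 2 cP / cNP` this bounds the cost by a piecewise linear function of `(c₁, c₂)`. Its minimum
is at `(n₁, n₂)`, `(n₁, 1)` or `(0, 1)`, that is, at 0, `n₂ - 1` or `n - 1` protected links; `T₂`
and `T₁` are the values of `r` at which neighbouring corners tie. If `k₁ = k₂`, only `c₁ + c₂`
matters and the middle corner drops out.

Each corner is attained. The delicate one has no protected links: a circulant graph of degree `k₁ +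
1` on all nodes, with the nodes of type 2 spread out, plus a Harary graph of degree `k₂ - k₁` on
those. A Harary cut may be one link short, but then its sides interleave on the cycle and the
circulant cut has a link to spare. -/

namespace IoT
open Finset

/-! ### Shifts of subsets of a finite abelian group -/

section Exits

variable {G : Type*} [AddCommGroup G] [Fintype G] [DecidableEq G]

/-- The elements of `A` that leave `A` when they are shifted by `d`. -/
def exits (A : Finset G) (d : G) : Finset G := univ.filter fun x => x ∈ A ∧ x + d ∉ A

lemma mem_exits {A : Finset G} {d x : G} : x ∈ exits A d ↔ x ∈ A ∧ x + d ∉ A := by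
  simp [exits]

/-- A shift that maps a finite set into itself also maps its complement into itself. -/
lemma add_mem_iff_of_exits_eq_empty {A : Finset G} {p : G} (h : exits A p = ∅) (x : G) :
    x + p ∈ A ↔ x ∈ A := by
  have h1 : ∀ x ∈ A, x + p ∈ A := fun x hx => by
    by_contra hp
    have : x ∈ exits A p := mem_exits.2 ⟨hx, hp⟩
    simp [h] at this
  have himg : A.image (· + p) = A := by
    refine eq_of_subset_of_card_le (fun y hy => ?_) ?_
    · obtain ⟨x, hx, rfl⟩ := mem_image.1 hy
      exact h1 x hx
    · rw [card_image_of_injective _ (add_left_injective p)]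
  refine ⟨fun hx => ?_, h1 x⟩
  rw [← himg] at hx
  obtain ⟨y, hy, hyx⟩ := mem_image.1 hx
  rwa [← add_right_cancel hyx]

/-- If `A` is invariant under `p`, then every shift that leaves `A` does so in at least three
places. -/
lemma three_le_card_exits {A : Finset G} {p d : G} (h : exits A p = ∅) (hp : p ≠ 0)
    (hp2 : p + p ≠ 0) (hd : exits A d ≠ ∅) : 3 ≤ (exits A d).card := by
  obtain ⟨x, hx⟩ := nonempty_iff_ne_empty.2 hd
  have step : ∀ y ∈ exits A d, y + p ∈ exits A d := fun y hy => by
    rw [mem_exits] at hy ⊢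
    rw [add_right_comm, add_mem_iff_of_exits_eq_empty h, add_mem_iff_of_exits_eq_empty h]
    exact hy
  have hsub : ({x, x + p, x + p + p} : Finset G) ⊆ exits A d := by
    intro y hy
    simp only [mem_insert, mem_singleton] at hy
    rcases hy with rfl | rfl | rfl
    exacts [hx, step _ hx, step _ (step _ hx)]
  have hcard : ({x, x + p, x + p + p} : Finset G).card = 3 := by
    rw [card_eq_three]
    refine ⟨x, x + p, x + p + p, by simpa using hp, ?_, by simpa using hp, rfl⟩
    rw [add_assoc]; simpa using hp2
  exact hcard ▸ card_le_card hsub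

end Exits

lemma natCast_ne_zero_of_lt {n a : ℕ} (h0 : 0 < a) (h : a < n) : (a : ZMod n) ≠ 0 := by
  rw [Ne, ZMod.natCast_eq_zero_iff]
  exact fun hd => absurd (Nat.le_of_dvd h0 hd) (by omega)

/-- A nonempty subset of `ZMod n` closed under adding 1 is everything. -/
lemma one_le_card_exits_one {n : ℕ} [NeZero n] {A : Finset (ZMod n)} {x y : ZMod n}
    (hx : x ∈ A) (hy : y ∉ A) : 1 ≤ (exits A 1).card := by
  by_contra h
  have h0 : exits A 1 = ∅ := card_eq_zero.1 (by omega)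
  have : ∀ k : ℕ, x + k ∈ A := fun k => by
    induction k with
    | zero => simpa using hx
    | succ k ih =>
      rw [Nat.cast_succ, ← add_assoc, add_mem_iff_of_exits_eq_empty h0]
      exact ih
  apply hy
  simpa using this (y - x).val

/-- Induction in steps of two: a consecutive pair adds at least 3 where 2 would do, and `f 1`
supplies the initial surplus. -/
lemma add_one_le_sum_of_three_le {f : ℕ → ℕ} (h1 : 3 ≤ f 1) (h : ∀ d, 1 ≤ d → 3 ≤ f d + f (d + 1)) :
    ∀ m, 1 ≤ m → m + 1 ≤ ∑ d ∈ Icc 1 m, f d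
  | 0, h0 => by omega
  | 1, _ => by simp; omega
  | 2, _ => by
      rw [sum_Icc_succ_top (by omega)]; simp; omega
  | m + 3, _ => by
      have := add_one_le_sum_of_three_le h1 h (m + 1) (by omega)
      have h2 : 3 ≤ f (m + 1 + 1) + f (m + 2 + 1) := h (m + 2) (by omega)
      rw [sum_Icc_succ_top (by omega), sum_Icc_succ_top (by omega)]
      omega

/-- The number of exits of `A` under the shifts by `1, …, m`. -/
lemma le_sum_card_exits {n m t : ℕ} [NeZero n] {A : Finset (ZMod n)} (hm : 1 ≤ m) (hmn : 2 * m < n)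
    (ht1 : 1 ≤ t) (ht2 : t ≤ 2) (h : t ≤ (exits A 1).card) :
    m + t ≤ 1 + ∑ d ∈ Icc 1 m, (exits A (d : ZMod n)).card := by
  -- Either some shift `p` preserves `A`, and then nonempty exit sets have at least three elements
  -- (`2 * m < n` gives `p + p ≠ 0`), or every shift contributes 1 and the shift by 1 contributes
  -- `t`.
  by_cases h0 : ∃ d ∈ Icc 1 m, exits A (d : ZMod n) = ∅
  · obtain ⟨p, hp, hpA⟩ := h0
    rw [mem_Icc] at hp
    have hp1 : (p : ZMod n) ≠ 0 := natCast_ne_zero_of_lt (by omega) (by omega)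
    have hp2 : (p : ZMod n) + p ≠ 0 := by
      have := natCast_ne_zero_of_lt (n := n) (a := p + p) (by omega) (by omega)
      exact_mod_cast this
    have h3 : ∀ d, exits A d ≠ ∅ → 3 ≤ (exits A d).card := fun d hd =>
      three_le_card_exits hpA hp1 hp2 hd
    have hone : exits A 1 ≠ ∅ := fun h' => by rw [h'] at h; simp at h; omega
    have := add_one_le_sum_of_three_le (f := fun d : ℕ => (exits A (d : ZMod n)).card)
      (by simpa using h3 1 hone) (fun d _ => by
        by_cases hd : exits A (d : ZMod n) = ∅
        -- Invariance under both `d` and `d + 1` would imply invariance under 1.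
        · have : exits A ((d + 1 : ℕ) : ZMod n) ≠ ∅ := fun h' => by
            apply hone
            ext x
            rw [mem_exits, ← add_mem_iff_of_exits_eq_empty h' x,
              ← add_mem_iff_of_exits_eq_empty hd (x + 1)]
            push_cast
            rw [add_right_comm, ← add_assoc]
            simp
          have := h3 _ this
          omega
        · have := h3 _ hd
          omega) m hm
    omega
  · push Not at h0
    obtain ⟨m, rfl⟩ : ∃ k, m = k + 1 := ⟨m - 1, by omega⟩
    have h1 : ∑ d ∈ Icc 2 (m + 1), 1 ≤ ∑ d ∈ Icc 2 (m + 1), (exits A (d : ZMod n)).card :=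
      sum_le_sum fun d hd => by
        rw [mem_Icc] at hd
        exact card_pos.2 (h0 d (mem_Icc.2 (by omega)))
    have h2 : ∑ d ∈ Icc 1 (m + 1), (exits A (d : ZMod n)).card =
        (exits A 1).card + ∑ d ∈ Icc 2 (m + 1), (exits A (d : ZMod n)).card := by
      rw [← add_sum_Ioc_eq_sum_Icc (by omega)]
      simp; rfl
    simp at h1
    omega

/-! ### Cuts -/

section Cut

variable {V W : Type*}

/-- The link `e` has exactly one end in `S`. -/
def Crosses (S : Finset V) (e : Sym2 V) : Prop := ∃ x ∈ S, ∃ y ∉ S, e = s(x, y)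

lemma crosses_mk_iff {S : Finset V} {x y : V} :
    Crosses S s(x, y) ↔ (x ∈ S ∧ y ∉ S) ∨ (y ∈ S ∧ x ∉ S) := by
  constructor
  · rintro ⟨a, ha, b, hb, h⟩
    rcases Sym2.eq_iff.1 h with ⟨rfl, rfl⟩ | ⟨rfl, rfl⟩
    exacts [Or.inl ⟨ha, hb⟩, Or.inr ⟨ha, hb⟩]
  · rintro (⟨hx, hy⟩ | ⟨hy, hx⟩)
    exacts [⟨x, hx, y, hy, rfl⟩, ⟨y, hy, x, hx, Sym2.eq_swap⟩]

open Classical in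
/-- The links of `E` with exactly one end in `S`. -/
noncomputable def cut (E : Finset (Sym2 V)) (S : Finset V) : Finset (Sym2 V) := E.filter (Crosses S)

lemma mem_cut {E : Finset (Sym2 V)} {S : Finset V} {e : Sym2 V} :
    e ∈ cut E S ↔ e ∈ E ∧ Crosses S e := by
  simp [cut]

lemma cut_mono {E F : Finset (Sym2 V)} (h : E ⊆ F) (S : Finset V) : cut E S ⊆ cut F S :=
  fun _ he => mem_cut.2 ⟨h (mem_cut.1 he).1, (mem_cut.1 he).2⟩

lemma card_cut_add_le [DecidableEq V] {E F : Finset (Sym2 V)} (h : Disjoint E F) (S : Finset V) :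
    (cut E S).card + (cut F S).card ≤ (cut (E ∪ F) S).card := by
  rw [← card_union_of_disjoint (h.mono (fun _ he => (mem_cut.1 he).1) fun _ he => (mem_cut.1 he).1)]
  exact card_le_card (union_subset (cut_mono subset_union_left S) (cut_mono subset_union_right S))

/-- Carries cut bounds from `ZMod n` over to its copy inside the network. -/
lemma card_cut_image [DecidableEq V] [Fintype W] [DecidableEq W] {ι : W → V}
    (hι : Function.Injective ι) (E : Finset (Sym2 W)) (S : Finset V) :
    (cut E (univ.filter fun w => ι w ∈ S)).card ≤ (cut (E.image (Sym2.map ι)) S).card := by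
  refine card_le_card_of_injOn (Sym2.map ι) (fun e he => ?_) ((Sym2.map.injective hι).injOn)
  obtain ⟨heE, x, hx, y, hy, rfl⟩ := mem_cut.1 he
  refine mem_cut.2 ⟨mem_image_of_mem _ heE, ι x, ?_, ι y, ?_, rfl⟩
  · simpa using hx
  · simpa using hy

end Cut

/-! ### Cuts of circulant graphs -/

section Circulant

/-- The links of the circulant graph on `ℤ/n` with the differences `1, …, m`. -/
def circulantLinks (n m : ℕ) [NeZero n] : Finset (Sym2 (ZMod n)) :=
  (univ ×ˢ Icc 1 m).image fun p : ZMod n × ℕ => s(p.1, p.1 + p.2)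

lemma mem_circulantLinks {n m : ℕ} [NeZero n] {e : Sym2 (ZMod n)} :
    e ∈ circulantLinks n m ↔ ∃ x : ZMod n, ∃ d : ℕ, (1 ≤ d ∧ d ≤ m) ∧ s(x, x + d) = e := by
  simp [circulantLinks]

lemma card_circulantLinks_le (n m : ℕ) [NeZero n] : (circulantLinks n m).card ≤ n * m := by
  refine card_image_le.trans ?_
  simp [ZMod.card]

lemma not_isDiag_of_mem_circulantLinks {n m : ℕ} [NeZero n] (hmn : m < n) {e : Sym2 (ZMod n)}
    (he : e ∈ circulantLinks n m) : ¬ e.IsDiag := by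
  obtain ⟨x, d, hd, rfl⟩ := mem_circulantLinks.1 he
  simpa using natCast_ne_zero_of_lt (n := n) (a := d) (by omega) (by omega)

/-- A link from `x` to `x + d` crosses the cut when `x` leaves `A` or its complement. No link is
counted twice: reading it backwards would need `d + d' = 0`, which `2 * m < n` forbids. -/
lemma sum_card_exits_le_card_cut {n m : ℕ} [NeZero n] (hmn : 2 * m < n) (A : Finset (ZMod n)) :
    ∑ d ∈ Icc 1 m, (exits A (d : ZMod n)).card + ∑ d ∈ Icc 1 m, (exits Aᶜ (d : ZMod n)).card ≤
      (cut (circulantLinks n m) A).card := by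
  rw [← sum_add_distrib]
  have hdisj : ∀ d : ℕ, Disjoint (exits A (d : ZMod n)) (exits Aᶜ (d : ZMod n)) := fun d =>
    disjoint_left.2 fun x hx hx' => by
      rw [mem_exits] at hx hx'
      exact mem_compl.1 hx'.1 hx.1
  simp_rw [← fun d : ℕ => card_union_of_disjoint (hdisj d)]
  rw [← card_sigma]
  refine card_le_card_of_injOn (fun p => s(p.2, p.2 + (p.1 : ZMod n))) ?_ ?_
  · rintro ⟨d, x⟩ hp
    simp only [coe_sigma, Set.mem_sigma_iff, mem_coe, mem_Icc, mem_union, mem_exits,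
      mem_compl] at hp
    refine mem_cut.2 ⟨mem_circulantLinks.2 ⟨x, d, hp.1, rfl⟩, crosses_mk_iff.2 ?_⟩
    tauto
  · rintro ⟨d, x⟩ hp ⟨d', x'⟩ hp' h
    simp only [coe_sigma, Set.mem_sigma_iff, mem_coe, mem_Icc] at hp hp'
    rcases Sym2.eq_iff.1 h with ⟨h1, h2⟩ | ⟨h1, h2⟩
    · simp only at h1 h2
      subst h1
      have h3 := add_left_cancel h2
      rw [ZMod.natCast_eq_natCast_iff', Nat.mod_eq_of_lt (by omega),
        Nat.mod_eq_of_lt (by omega)] at h3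
      subst h3
      rfl
    · exfalso
      simp only at h1 h2
      apply natCast_ne_zero_of_lt (n := n) (a := d' + d) (by omega) (by omega)
      rw [h1, add_assoc] at h2
      push_cast
      simpa using h2

/-- Over the shifts `1, …, m`, both `A` and its complement have at least `m` exits. -/
lemma two_mul_le_card_cut_circulantLinks {n m : ℕ} [NeZero n] (hmn : 2 * m < n)
    {A : Finset (ZMod n)} {x y : ZMod n} (hx : x ∈ A) (hy : y ∉ A) :
    2 * m ≤ (cut (circulantLinks n m) A).card := by
  rcases Nat.eq_zero_or_pos m with rfl | hm
  · simp
  have h1 := le_sum_card_exits hm hmn le_rfl one_le_two (one_le_card_exits_one hx hy)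
  have h2 := le_sum_card_exits (A := Aᶜ) hm hmn le_rfl one_le_two
    (one_le_card_exits_one (mem_compl.2 hy) (by simpa using hx))
  have := sum_card_exits_le_card_cut hmn A
  omega

lemma exists_change_of_lt {P : ℕ → Prop} {a b : ℕ} (hab : a < b) (ha : P a)
    (hb : ¬ P b) : ∃ c, a ≤ c ∧ c < b ∧ P c ∧ ¬ P (c + 1) := by
  by_contra! h
  have : ∀ k, a + k ≤ b → P (a + k) := fun k => by
    induction k with
    | zero => exact fun _ => ha
    | succ k ih => exact fun hk => h (a + k) (by omega) (by omega) (ih (by omega))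
  exact hb (by simpa [Nat.add_sub_cancel' hab.le] using this (b - a) (by omega))

lemma two_le_card_exits_one {n : ℕ} [NeZero n] {A : Finset (ZMod n)} {a b c d : ℕ} (hab : a < b)
    (hbc : b < c) (hcd : c < d) (hdn : d < n) (ha : (a : ZMod n) ∈ A) (hb : (b : ZMod n) ∉ A)
    (hc : (c : ZMod n) ∈ A) (hd : (d : ZMod n) ∉ A) : 2 ≤ (exits A 1).card := by
  obtain ⟨u, hu1, hu2, hu3, hu4⟩ :=
    exists_change_of_lt (P := fun k => (k : ZMod n) ∈ A) hab ha hb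
  obtain ⟨v, hv1, hv2, hv3, hv4⟩ :=
    exists_change_of_lt (P := fun k => (k : ZMod n) ∈ A) hcd hc hd
  have hne : (u : ZMod n) ≠ v := by
    rw [Ne, ZMod.natCast_eq_natCast_iff', Nat.mod_eq_of_lt (by omega), Nat.mod_eq_of_lt (by omega)]
    omega
  rw [← card_pair hne]
  refine card_le_card fun x hx => ?_
  push_cast at hu4 hv4
  simp only [mem_insert, mem_singleton] at hx
  rcases hx with rfl | rfl
  exacts [mem_exits.2 ⟨hu3, hu4⟩, mem_exits.2 ⟨hv3, hv4⟩]

/-- If `A` and its complement interleave along the cycle, then the cut is larger than a vertex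
star. -/
lemma two_mul_lt_card_cut_circulantLinks {n m : ℕ} [NeZero n] (hm : 1 ≤ m) (hmn : 2 * m < n)
    {A : Finset (ZMod n)} {a b c d : ℕ} (hab : a < b)
    (hbc : b < c) (hcd : c < d) (hdn : d < n) (ha : (a : ZMod n) ∈ A) (hb : (b : ZMod n) ∉ A)
    (hc : (c : ZMod n) ∈ A) (hd : (d : ZMod n) ∉ A) :
    2 * m < (cut (circulantLinks n m) A).card := by
  -- Interleaving allows `t = 2`, hence `m + 1` exits for `A` and `m` for its complement.
  have h1 := le_sum_card_exits hm hmn one_le_two le_rfl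
    (two_le_card_exits_one hab hbc hcd hdn ha hb hc hd)
  have h2 := le_sum_card_exits (A := Aᶜ) hm hmn le_rfl one_le_two
    (one_le_card_exits_one (mem_compl.2 hb) (by simpa using ha))
  have := sum_card_exits_le_card_cut hmn A
  omega

end Circulant

end IoT

/-! ### Resistance through cuts, and lower bounds on the number of links -/

namespace IoT
open Finset

variable {n₁ n₂ : ℕ}

/-- No link is left across a cut all of whose links have been removed. -/
lemma mem_of_reachable_afterAttack {g : Design n₁ n₂} {EA : Finset (Sym2 (Node n₁ n₂))}
    {S : Finset (Node n₁ n₂)} (hP : cut g.EP S = ∅) (hN : cut g.ENP S ⊆ EA) {i j : Node n₁ n₂}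
    (h : (g.afterAttack EA).Reachable i j) (hi : i ∈ S) : j ∈ S := by
  obtain ⟨p⟩ := h
  induction p with
  | nil => exact hi
  | @cons u v w hadj _ ih =>
    refine ih ?_
    by_contra hv
    have hc : Crosses S s(u, v) := ⟨u, hi, v, hv, rfl⟩
    rw [Design.afterAttack, SimpleGraph.fromEdgeSet_adj, mem_coe, mem_union, mem_sdiff] at hadj
    rcases hadj.1 with h | h
    · have : s(u, v) ∈ cut g.EP S := mem_cut.2 ⟨h, hc⟩
      simp [hP] at this
    · exact h.2 (hN (mem_cut.2 ⟨h.1, hc⟩))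

/-- `t` is at most the size of every cut that separates `i` from `j` and that no protected link
crosses iff `i` and `j` remain connected under all attacks on fewer than `t` links. -/
lemma forall_reachable_iff_forall_le_card_cut (g : Design n₁ n₂) (k : ℕ) (i j : Node n₁ n₂) :
    (∀ EA ⊆ g.ENP, EA.card ≤ k → (g.afterAttack EA).Reachable i j) ↔
      ∀ S : Finset (Node n₁ n₂), cut g.EP S = ∅ → i ∈ S → j ∉ S → k + 1 ≤ (cut g.ENP S).card := by
  constructor
  · intro h S hS hi hj
    by_contra! hc
    exact hj (mem_of_reachable_afterAttack hS subset_rfl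
      (h _ (fun _ he => (mem_cut.1 he).1) (by omega)) hi)
  · intro h EA hEA hcard
    by_contra hr
    classical
    -- The witness cut is the component of `i` after the attack: no surviving link leaves it.
    have key : ∀ e, e ∈ g.EP ∪ (g.ENP \ EA) →
        ¬ Crosses (univ.filter fun x => (g.afterAttack EA).Reachable i x) e := by
      rintro e he ⟨x, hx, y, hy, rfl⟩
      simp only [mem_filter, mem_univ, true_and] at hx hy
      have hadj : (g.afterAttack EA).Adj x y := by
        rw [Design.afterAttack, SimpleGraph.fromEdgeSet_adj]
        refine ⟨he, ?_⟩
        rintro rfl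
        exact hy hx
      exact hy (hx.trans hadj.reachable)
    have := h (univ.filter fun x => (g.afterAttack EA).Reachable i x)
      (eq_empty_of_forall_notMem fun e he =>
        key e (mem_union_left _ (mem_cut.1 he).1) (mem_cut.1 he).2)
      (by simp) (by simpa using hr)
    have hle : (cut g.ENP (univ.filter fun x => (g.afterAttack EA).Reachable i x)) ⊆ EA := by
      intro e he
      by_contra heA
      exact key e (mem_union_right _ (mem_sdiff.2 ⟨(mem_cut.1 he).1, heA⟩)) (mem_cut.1 he).2
    have := card_le_card hle
    omega

/-- Resistance in terms of cuts. -/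
lemma isResistant_iff_cut {k₁ k₂ : ℕ} {g : Design n₁ n₂} :
    g.IsResistant k₁ k₂ ↔
      (∀ S : Finset (Node n₁ n₂), cut g.EP S = ∅ → ∀ i ∈ S, ∀ j ∉ S,
        k₁ + 1 ≤ (cut g.ENP S).card) ∧
      (∀ S : Finset (Node n₁ n₂), cut g.EP S = ∅ → ∀ i j : Fin n₂, Sum.inr i ∈ S → Sum.inr j ∉ S →
        k₂ + 1 ≤ (cut g.ENP S).card) := by
  have h1 := forall_reachable_iff_forall_le_card_cut g k₁
  have h2 := fun i j : Fin n₂ =>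
    forall_reachable_iff_forall_le_card_cut g k₂ (Sum.inr i) (Sum.inr j)
  constructor
  · rintro ⟨h, h'⟩
    exact ⟨fun S hS i hi j hj => (h1 i j).1 (fun EA hE hc => h EA hE hc i j) S hS hi hj,
      fun S hS i j hi hj => (h2 i j).1 (fun EA hE hc => h' EA hE hc i j) S hS hi hj⟩
  · rintro ⟨h, h'⟩
    exact ⟨fun EA hE hc i j => (h1 i j).2 (fun S hS hi hj => h S hS i hi j hj) EA hE hc,
      fun EA hE hc i j => (h2 i j).2 (fun S hS hi hj => h' S hS i j hi hj) EA hE hc⟩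

/-- A finite graph has a labelling of its vertices that is constant along its edges and has at
least `|V| - |E|` values. -/
lemma exists_labelling {V : Type*} [Fintype V] [DecidableEq V] (E : Finset (Sym2 V)) :
    ∃ f : V → V, (∀ x y, s(x, y) ∈ E → f x = f y) ∧
      Fintype.card V ≤ E.card + (univ.image f).card := by
  induction E using Finset.induction_on with
  | empty => exact ⟨id, by simp, by simp⟩
  | insert e E he ih =>
    obtain ⟨f, hf, hcard⟩ := ih
    induction e using Sym2.ind with
    | _ a b =>
      -- The new link merges the class of `b` into that of `a`, which loses at most one label.
      refine ⟨fun x => if f x = f b then f a else f x, fun x y hxy => ?_, ?_⟩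
      · rcases mem_insert.1 hxy with h | h
        · rcases Sym2.eq_iff.1 h with ⟨rfl, rfl⟩ | ⟨rfl, rfl⟩ <;> simp
        · simp [hf x y h]
      · have hsub : (univ.image f).erase (f b) ⊆
            univ.image fun x => if f x = f b then f a else f x := by
          intro y hy
          obtain ⟨hyb, hy⟩ := mem_erase.1 hy
          obtain ⟨x, -, rfl⟩ := mem_image.1 hy
          exact mem_image.2 ⟨x, mem_univ _, by simp [hyb]⟩
        have := card_le_card hsub
        rw [card_erase_of_mem (mem_image_of_mem _ (mem_univ _))] at this
        rw [card_insert_of_notMem he]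
        omega

/-- Every link crosses at most two classes of a labelling. -/
lemma sum_card_cut_fiber_le {V L : Type*} [Fintype V] [DecidableEq L] (f : V → L)
    (E : Finset (Sym2 V)) (C : Finset L) :
    ∑ c ∈ C, (cut E (univ.filter fun x => f x = c)).card ≤ 2 * E.card := by
  classical
  have hswap : ∑ c ∈ C, (cut E (univ.filter fun x => f x = c)).card =
      ∑ e ∈ E, (C.filter fun c => Crosses (univ.filter fun x => f x = c) e).card := by
    simp_rw [cut, card_filter]
    rw [sum_comm]
  rw [hswap, mul_comm, ← smul_eq_mul]
  refine sum_le_card_nsmul _ _ _ fun e _ => ?_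
  induction e using Sym2.ind with
  | _ a b =>
    refine (card_le_card (t := {f a, f b}) fun c hc => ?_).trans card_le_two
    have := crosses_mk_iff.1 (mem_filter.1 hc).2
    simp only [mem_filter, mem_univ, true_and] at this
    simp only [mem_insert, mem_singleton]
    rcases this with h | h
    exacts [Or.inl h.1.symm, Or.inr h.1.symm]

/-- Lower bounds on the number of links of a resistant network: `c₁` and `c₂` are the numbers of
connected components of the protected network without and with nodes of type 2. -/
lemma Design.IsResistant.exists_bounds {k₁ k₂ : ℕ} {g : Design n₁ n₂} (hg : g.IsResistant k₁ k₂)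
    (hn₂ : 1 ≤ n₂) :
    ∃ c₁ c₂ : ℕ, c₁ ≤ n₁ ∧ 1 ≤ c₂ ∧ c₂ ≤ n₂ ∧ n₁ + n₂ ≤ g.EP.card + c₁ + c₂ ∧
      (2 ≤ c₂ → c₁ * (k₁ + 1) + c₂ * (k₂ + 1) ≤ 2 * g.ENP.card) ∧
      (c₂ = 1 → 1 ≤ c₁ → (c₁ + 1) * (k₁ + 1) ≤ 2 * g.ENP.card) := by
  obtain ⟨f, hf, hcard⟩ := exists_labelling g.EP
  rw [isResistant_iff_cut] at hg
  -- `D` collects the classes that contain a node of type 2; `C \ D` will be counted by `c₁`.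
  set D : Finset (Node n₁ n₂) := univ.image fun j : Fin n₂ => f (Sum.inr j) with hD
  set C : Finset (Node n₁ n₂) := univ.image f with hC
  have hDC : D ⊆ C := fun c hc => by
    obtain ⟨j, -, rfl⟩ := mem_image.1 hc
    exact mem_image_of_mem _ (mem_univ _)
  have hcut : ∀ c, cut g.EP (univ.filter fun x => f x = c) = ∅ := fun c =>
    eq_empty_of_forall_notMem fun e he => by
      obtain ⟨heE, x, hx, y, hy, rfl⟩ := mem_cut.1 he
      simp only [mem_filter, mem_univ, true_and] at hx hy
      exact hy ((hf x y heE).symm.trans hx)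
  have hcardC : (C \ D).card + D.card = C.card := card_sdiff_add_card_eq_card hDC
  have h1 : ∀ c ∈ C, 1 < C.card → k₁ + 1 ≤ (cut g.ENP (univ.filter fun x => f x = c)).card := by
    intro c hc hlt
    obtain ⟨i, -, rfl⟩ := mem_image.1 hc
    obtain ⟨b, hb, hbc⟩ := exists_mem_ne hlt (f i)
    obtain ⟨j, -, rfl⟩ := mem_image.1 hb
    exact hg.1 _ (hcut _) i (by simp) j (by simpa using hbc)
  have h2 : ∀ c ∈ D, 1 < D.card → k₂ + 1 ≤ (cut g.ENP (univ.filter fun x => f x = c)).card := by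
    intro c hc hlt
    obtain ⟨i, -, rfl⟩ := mem_image.1 hc
    obtain ⟨b, hb, hbc⟩ := exists_mem_ne hlt (f (Sum.inr i))
    obtain ⟨j, -, rfl⟩ := mem_image.1 hb
    exact hg.2 _ (hcut _) i j (by simp) (by simpa using hbc)
  have hsum := sum_card_cut_fiber_le f g.ENP C
  rw [Fintype.card_sum, Fintype.card_fin, Fintype.card_fin] at hcard
  refine ⟨(C \ D).card, D.card, ?_, ?_, ?_, by omega, fun h => ?_, fun hd hc => ?_⟩
  · have hsub : C \ D ⊆ univ.image fun i : Fin n₁ => f (Sum.inl i) := fun c hc => by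
      obtain ⟨hcC, hcD⟩ := mem_sdiff.1 hc
      obtain ⟨x, -, rfl⟩ := mem_image.1 hcC
      rcases x with i | j
      · exact mem_image_of_mem (fun i : Fin n₁ => f (Sum.inl i)) (mem_univ i)
      · exact absurd (mem_image_of_mem (fun j : Fin n₂ => f (Sum.inr j)) (mem_univ j)) hcD
    simpa using (card_le_card hsub).trans card_image_le
  · exact card_pos.2 ⟨f (Sum.inr ⟨0, hn₂⟩),
      mem_image_of_mem (fun j : Fin n₂ => f (Sum.inr j)) (mem_univ _)⟩
  · simpa using card_image_le (s := univ) (f := fun j : Fin n₂ => f (Sum.inr j))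
  · refine le_trans ?_ hsum
    rw [← sum_sdiff hDC, ← smul_eq_mul, ← smul_eq_mul]
    exact add_le_add
      (card_nsmul_le_sum _ _ _ fun c hc => h1 c (mem_sdiff.1 hc).1 (by omega))
      (card_nsmul_le_sum _ _ _ fun c hc => h2 c hc (by omega))
  -- With a single class in `D`, no class separates two nodes of type 2, so each guarantees only `k₁
  -- + 1`.
  · refine le_trans ?_ hsum
    have heq : ((C \ D).card + 1) * (k₁ + 1) = C.card • (k₁ + 1) := by
      rw [← hcardC, hd, smul_eq_mul]
    rw [heq]
    exact card_nsmul_le_sum _ _ _ fun c hc => h1 c hc (by omega)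

end IoT

/-! ### Resistant networks attaining the bounds -/

namespace IoT
open Finset

variable {n₁ n₂ : ℕ}

section Star

variable {V : Type*} [DecidableEq V]

/-- The star with centre `v` and leaves `T`. -/
def starLinks (v : V) (T : Finset V) : Finset (Sym2 V) := T.image fun x => s(v, x)

lemma mem_starLinks {v : V} {T : Finset V} {e : Sym2 V} :
    e ∈ starLinks v T ↔ ∃ x ∈ T, s(v, x) = e := by
  simp [starLinks]

lemma card_starLinks (v : V) (T : Finset V) : (starLinks v T).card = T.card :=
  card_image_of_injective _ fun _ _ h => Sym2.congr_right.1 h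

lemma not_isDiag_of_mem_starLinks {v : V} {T : Finset V} (hv : v ∉ T) {e : Sym2 V}
    (he : e ∈ starLinks v T) : ¬ e.IsDiag := by
  obtain ⟨x, hx, rfl⟩ := mem_starLinks.1 he
  rw [Sym2.mk_isDiag_iff]
  rintro rfl
  exact hv hx

lemma mem_iff_of_cut_starLinks_eq_empty {v : V} {T S : Finset V} (h : cut (starLinks v T) S = ∅)
    {x : V} (hx : x ∈ T) : x ∈ S ↔ v ∈ S := by
  have h' : ¬ Crosses S s(v, x) := fun hc => by
    have : s(v, x) ∈ cut (starLinks v T) S := mem_cut.2 ⟨mem_starLinks.2 ⟨x, hx, rfl⟩, hc⟩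
    simp [h] at this
  rw [crosses_mk_iff] at h'
  tauto

end Star

/-- A protected spanning tree. -/
lemma exists_isResistant_tree (k₁ k₂ : ℕ) (hn₂ : 1 ≤ n₂) :
    ∃ g : Design n₁ n₂, g.IsResistant k₁ k₂ ∧ g.EP.card = n₁ + n₂ - 1 ∧ g.ENP.card = 0 := by
  let v : Node n₁ n₂ := Sum.inr ⟨0, hn₂⟩
  refine ⟨⟨starLinks v (univ.erase v), ∅, by simp,
    fun e he => not_isDiag_of_mem_starLinks (by simp) he, by simp⟩, ?_, ?_, by simp⟩
  · have key : ∀ S : Finset (Node n₁ n₂), cut (starLinks v (univ.erase v)) S = ∅ →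
        ∀ x, x ∈ S ↔ v ∈ S := fun S hS x => by
      by_cases hx : x = v
      · rw [hx]
      · exact mem_iff_of_cut_starLinks_eq_empty hS (by simp [hx])
    refine isResistant_iff_cut.2 ⟨fun S hS i hi j hj => ?_, fun S hS i j hi hj => ?_⟩
    · exact absurd ((key S hS j).2 ((key S hS i).1 hi)) hj
    · exact absurd ((key S hS _).2 ((key S hS _).1 hi)) hj
  · simp only [card_starLinks]
    rw [card_erase_of_mem (mem_univ _)]
    simp

/-- A protected tree on the nodes of type 2, to one node of which the nodes of type 1 are joined
by a circulant graph. -/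
lemma exists_isResistant_partial {k₁ m : ℕ} (k₂ : ℕ) (hm : k₁ + 1 = 2 * m) (hn₁ : k₁ + 1 ≤ n₁)
    (hn₂ : 1 ≤ n₂) :
    ∃ g : Design n₁ n₂, g.IsResistant k₁ k₂ ∧ g.EP.card = n₂ - 1 ∧
      2 * g.ENP.card ≤ (n₁ + 1) * (k₁ + 1) := by
  let z : Fin n₂ := ⟨0, hn₂⟩
  let T : Finset (Node n₁ n₂) := (univ.erase z).image Sum.inr
  -- The circulant graph lives on the nodes of type 1 and the hub `z`, represented by `none`.
  let e : ZMod (n₁ + 1) ≃ Option (Fin n₁) := Fintype.equivOfCardEq (by simp [ZMod.card])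
  let ι : ZMod (n₁ + 1) → Node n₁ n₂ := fun w => (e w).elim (Sum.inr z) Sum.inl
  have hι : Function.Injective ι := by
    intro a b hab
    apply e.injective
    simp only [ι] at hab
    cases ha : e a <;> cases hb : e b <;> simp_all
  have hιr : ∀ w j, ι w = Sum.inr j → j = z := by
    intro w j h
    simp only [ι] at h
    cases hw : e w <;> simp_all
  have hιl : ∀ i, ∃ w, ι w = Sum.inl i := fun i => ⟨e.symm (some i), by simp [ι]⟩
  have hιz : ∃ w, ι w = Sum.inr z := ⟨e.symm none, by simp [ι]⟩
  have hdisj : Disjoint (starLinks (Sum.inr z) T)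
      ((circulantLinks (n₁ + 1) m).image (Sym2.map ι)) := by
    refine disjoint_left.2 fun l hl hl' => ?_
    obtain ⟨x, hx, rfl⟩ := mem_starLinks.1 hl
    obtain ⟨j, hj, rfl⟩ := mem_image.1 hx
    obtain ⟨l, -, h⟩ := mem_image.1 hl'
    have hmem : (Sum.inr j : Node n₁ n₂) ∈ Sym2.map ι l := by rw [h]; simp
    obtain ⟨w, -, hw⟩ := Sym2.mem_map.1 hmem
    exact (mem_erase.1 hj).1 (hιr w j hw)
  refine ⟨⟨starLinks (Sum.inr z) T, (circulantLinks (n₁ + 1) m).image (Sym2.map ι), hdisj,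
    fun l hl => not_isDiag_of_mem_starLinks (by simp [T]) hl, fun l hl => ?_⟩, ?_, ?_, ?_⟩
  · obtain ⟨l', hl', rfl⟩ := mem_image.1 hl
    rw [Sym2.isDiag_map hι]
    exact not_isDiag_of_mem_circulantLinks (by omega) hl'
  · have key : ∀ S : Finset (Node n₁ n₂), cut (starLinks (Sum.inr z) T) S = ∅ →
        ∀ j : Fin n₂, Sum.inr j ∈ S ↔ Sum.inr z ∈ S := fun S hS j => by
      by_cases hj : j = z
      · rw [hj]
      · exact mem_iff_of_cut_starLinks_eq_empty hS (by simp [T, hj])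
    -- All nodes of type 2 lie on the side of `z`, so a proper cut stays proper on the circulant
    -- graph.
    have hpre : ∀ S : Finset (Node n₁ n₂), cut (starLinks (Sum.inr z) T) S = ∅ →
        ∀ x, ∃ w, ι w ∈ S ↔ x ∈ S := fun S hS x => by
      rcases x with i | j
      · obtain ⟨w, hw⟩ := hιl i
        exact ⟨w, by rw [hw]⟩
      · obtain ⟨w, hw⟩ := hιz
        exact ⟨w, by rw [hw, key S hS j]⟩
    refine isResistant_iff_cut.2 ⟨fun S hS i hi j hj => ?_, fun S hS i j hi hj => ?_⟩
    · obtain ⟨u, hu⟩ := hpre S hS i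
      obtain ⟨w, hw⟩ := hpre S hS j
      rw [hm]
      refine le_trans ?_ (card_cut_image hι (circulantLinks (n₁ + 1) m) S)
      exact two_mul_le_card_cut_circulantLinks (x := u) (y := w) (by omega)
        (by simpa using hu.2 hi) (by simpa using fun h => hj (hw.1 h))
    · exact absurd ((key S hS j).2 ((key S hS i).1 hi)) hj
  · simp only [card_starLinks, T]
    rw [card_image_of_injective _ Sum.inr_injective, card_erase_of_mem (mem_univ _)]
    simp
  · have h1 : ((circulantLinks (n₁ + 1) m).image (Sym2.map ι)).card ≤ (n₁ + 1) * m :=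
      card_image_le.trans (card_circulantLinks_le _ _)
    simp only [hm]
    linarith

/-! ### Harary graphs and the network without protected links -/

section Harary

/-- The links between opposite elements of `ℤ/n`, for even `n`. -/
def diameterLinks (n : ℕ) : Finset (Sym2 (ZMod n)) :=
  (range (n / 2)).image fun j : ℕ => s((j : ZMod n), ((j + n / 2 : ℕ) : ZMod n))

lemma mem_diameterLinks {n : ℕ} {e : Sym2 (ZMod n)} :
    e ∈ diameterLinks n ↔ ∃ j < n / 2, s((j : ZMod n), ((j + n / 2 : ℕ) : ZMod n)) = e := by
  simp [diameterLinks]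

/-- A diameter has difference `n / 2` in both directions, and circulant differences are at most `q <
n / 2`. -/
lemma disjoint_circulantLinks_diameterLinks {n q : ℕ} [NeZero n] (hn : n % 2 = 0)
    (hq : 2 * q + 1 < n) : Disjoint (circulantLinks n q) (diameterLinks n) := by
  refine disjoint_left.2 fun e he he' => ?_
  obtain ⟨x, d, hd, rfl⟩ := mem_circulantLinks.1 he
  obtain ⟨j, hj, h⟩ := mem_diameterLinks.1 he'
  push_cast at h
  rcases Sym2.eq_iff.1 h with ⟨rfl, h2⟩ | ⟨h1, h2⟩
  · have h3 := add_left_cancel h2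
    rw [ZMod.natCast_eq_natCast_iff', Nat.mod_eq_of_lt (by omega), Nat.mod_eq_of_lt (by omega)] at h3
    omega
  · rw [h1, add_assoc] at h2
    apply natCast_ne_zero_of_lt (n := n) (a := d + n / 2) (by omega) (by omega)
    push_cast
    simpa using h2

/-- The links of a graph on `ℤ/n` in which the degree of each vertex is `d`: a circulant graph,
together with all diameters if `d` is odd. -/
def hararyLinks (n d : ℕ) [NeZero n] : Finset (Sym2 (ZMod n)) :=
  circulantLinks n (d / 2) ∪ if d % 2 = 1 then diameterLinks n else ∅

lemma two_mul_card_hararyLinks_le {n d : ℕ} [NeZero n] :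
    2 * (hararyLinks n d).card ≤ n * d := by
  have h1 := card_circulantLinks_le n (d / 2)
  have h2 : (diameterLinks n).card ≤ n / 2 := card_image_le.trans (by simp)
  have h3 := card_union_le (circulantLinks n (d / 2)) (if d % 2 = 1 then diameterLinks n else ∅)
  rw [← hararyLinks] at h3
  split_ifs at h3 with hd
  · have h4 : n * d = 2 * (n * (d / 2)) + n := by
      conv_lhs => rw [show d = 2 * (d / 2) + 1 by omega]
      ring
    omega
  · have h4 : n * d = 2 * (n * (d / 2)) := by
      conv_lhs => rw [show d = 2 * (d / 2) by omega]
      ring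
    simp only [card_empty] at h3
    omega

lemma not_isDiag_of_mem_hararyLinks {n d : ℕ} [NeZero n] (hdn : d < n) {e : Sym2 (ZMod n)}
    (he : e ∈ hararyLinks n d) : ¬ e.IsDiag := by
  rcases mem_union.1 he with he | he
  · exact not_isDiag_of_mem_circulantLinks (by omega) he
  · split_ifs at he with hd
    · obtain ⟨j, hj, rfl⟩ := mem_diameterLinks.1 he
      simpa using natCast_ne_zero_of_lt (n := n) (a := n / 2) (by omega) (by omega)
    · simp at he

/-- Every cut of `hararyLinks n d` has at least `d` links, except that it may have just `d - 1` of
them if the two sides of the cut interleave. -/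
lemma le_card_cut_hararyLinks {n d : ℕ} [NeZero n] (hdn : d < n) (hpar : n * d % 2 = 0)
    {A : Finset (ZMod n)} {x y : ZMod n} (hx : x ∈ A) (hy : y ∉ A) :
    d ≤ (cut (hararyLinks n d) A).card ∨
      (d ≤ (cut (hararyLinks n d) A).card + 1 ∧
        ∃ a b c e : ℕ, a < b ∧ b < c ∧ c < e ∧ e < n ∧
          (((a : ZMod n) ∈ A ∧ (b : ZMod n) ∉ A ∧ (c : ZMod n) ∈ A ∧ (e : ZMod n) ∉ A) ∨
          ((a : ZMod n) ∉ A ∧ (b : ZMod n) ∈ A ∧ (c : ZMod n) ∉ A ∧ (e : ZMod n) ∈ A))) := by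
  have h1 := two_mul_le_card_cut_circulantLinks (m := d / 2) (by omega) hx hy
  have h2 := card_le_card (cut_mono (F := hararyLinks n d)
    (subset_union_left (s₁ := circulantLinks n (d / 2))) A)
  by_cases hd : d % 2 = 1
  swap
  · left; omega
  have hn : n % 2 = 0 := by
    rcases Nat.mod_two_eq_zero_or_one n with h | h
    · exact h
    · rw [Nat.mul_mod, h, hd] at hpar; omega
  -- For odd `d` the circulant part gives only `d - 1`. A crossing diameter supplies the missing
  -- link; if none crosses, `A` is invariant under the antipodal map.
  by_cases hdiam : cut (diameterLinks n) A = ∅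
  swap
  · left
    have h3 := card_pos.2 (nonempty_iff_ne_empty.2 hdiam)
    have h4 := card_cut_add_le (disjoint_circulantLinks_diameterLinks (q := d / 2) hn (by omega)) A
    rw [hararyLinks, if_pos hd]
    omega
  refine Or.inr ⟨by omega, ?_⟩
  have hiff : ∀ j < n / 2, ((j : ZMod n) ∈ A ↔ ((j + n / 2 : ℕ) : ZMod n) ∈ A) := fun j hj => by
    have : ¬ Crosses A s((j : ZMod n), ((j + n / 2 : ℕ) : ZMod n)) := fun hc => by
      have : s((j : ZMod n), ((j + n / 2 : ℕ) : ZMod n)) ∈ cut (diameterLinks n) A :=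
        mem_cut.2 ⟨mem_diameterLinks.2 ⟨j, hj, rfl⟩, hc⟩
      simp [hdiam] at this
    rw [crosses_mk_iff] at this
    tauto
  have hred : ∀ x : ZMod n, ∃ a < n / 2, ((a : ZMod n) ∈ A ↔ x ∈ A) := fun x => by
    have hval := ZMod.val_lt x
    by_cases h : x.val < n / 2
    · exact ⟨x.val, h, by rw [ZMod.natCast_zmod_val]⟩
    · refine ⟨x.val - n / 2, by omega, ?_⟩
      rw [hiff _ (by omega), Nat.sub_add_cancel (by omega), ZMod.natCast_zmod_val]
  -- Representatives of the two sides in the lower half alternate with their antipodes.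
  obtain ⟨a, ha, haA⟩ := hred x
  obtain ⟨b, hb, hbA⟩ := hred y
  have haA := haA.2 hx
  have hbA := fun h => hy (hbA.1 h)
  have haA' := (hiff a ha).1 haA
  have hbA' := fun h => hbA ((hiff b hb).2 h)
  rcases lt_trichotomy a b with h | h | h
  · exact ⟨a, b, a + n / 2, b + n / 2, h, by omega, by omega, by omega,
      Or.inl ⟨haA, hbA, haA', hbA'⟩⟩
  · rw [h] at haA
    exact absurd haA hbA
  · exact ⟨b, a, b + n / 2, a + n / 2, h, by omega, by omega, by omega,
      Or.inr ⟨hbA, haA, hbA', haA'⟩⟩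

end Harary

lemma cut_compl {V : Type*} [Fintype V] [DecidableEq V] (E : Finset (Sym2 V)) (S : Finset V) :
    cut E Sᶜ = cut E S := by
  ext e
  induction e using Sym2.ind with
  | _ x y =>
    simp only [mem_cut, crosses_mk_iff, mem_compl]
    tauto

/-- There is room because `n₂ * (m + 1) ≤ n₁ + n₂`. The spacing keeps nodes of type 2 more than `m`
apart, and the increasing order preserves interleaving. -/
lemma exists_placement {m : ℕ} (h : n₂ * m ≤ n₁) (hn₂ : 1 ≤ n₂) :
    ∃ π : ZMod (n₁ + n₂) ≃ Node n₁ n₂, ∀ j : Fin n₂,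
      π ((j.val * (m + 1) : ℕ) : ZMod (n₁ + n₂)) = Sum.inr j := by
  have : NeZero (n₁ + n₂) := ⟨by omega⟩
  have hlt : ∀ j : Fin n₂, j.val * (m + 1) < n₁ + n₂ := fun j => by
    have := Nat.mul_le_mul_right (m + 1) (Nat.succ_le_of_lt j.2)
    rw [Nat.succ_mul, mul_add n₂, mul_one] at this
    omega
  obtain ⟨e, he⟩ := Finset.exists_equiv_extend_of_card_eq (α := Node n₁ n₂)
    (t := (univ : Finset (ZMod (n₁ + n₂)))) (s := univ.image Sum.inr)
    (f := Sum.elim (fun _ => 0) fun j => ((j.val * (m + 1) : ℕ) : ZMod (n₁ + n₂)))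
    (by simp [ZMod.card]) (subset_univ _) (by
      intro a ha b hb hab
      simp only [coe_image, coe_univ, Set.image_univ, Set.mem_range] at ha hb
      obtain ⟨i, rfl⟩ := ha
      obtain ⟨j, rfl⟩ := hb
      simp only [Sum.elim_inr] at hab
      rw [ZMod.natCast_eq_natCast_iff', Nat.mod_eq_of_lt (hlt i), Nat.mod_eq_of_lt (hlt j)] at hab
      rw [Fin.ext (Nat.eq_of_mul_eq_mul_right (Nat.succ_pos m) hab)])
  refine ⟨(e.trans (Equiv.subtypeUnivEquiv mem_univ)).symm, fun j => ?_⟩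
  rw [Equiv.symm_apply_eq]
  exact (he (Sum.inr j) (mem_image_of_mem _ (mem_univ j))).symm

/-- Multiples of `m + 1` are not neighbours in a circulant graph with differences up to `m`. -/
lemma mul_add_ne_mul {n₁ n₂ m i j d : ℕ} (h : n₂ * m ≤ n₁) (hi : i < n₂) (hj : j < n₂)
    (hd1 : 1 ≤ d) (hdm : d ≤ m) :
    ((i * (m + 1) : ℕ) : ZMod (n₁ + n₂)) + (d : ℕ) ≠ ((j * (m + 1) : ℕ) : ZMod (n₁ + n₂)) := by
  -- The slack `m` rules out wrapping around, so the equation holds in `ℕ`, where reduction modulo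
  -- `m + 1` forces `d = 0`.
  have hlt : ∀ j < n₂, j * (m + 1) + m < n₁ + n₂ := fun j hj => by
    have := Nat.mul_le_mul_right (m + 1) (Nat.succ_le_of_lt hj)
    rw [Nat.succ_mul, mul_add n₂, mul_one] at this
    omega
  intro heq
  have hi' := hlt i hi
  have hj' := hlt j hj
  rw [← Nat.cast_add, ZMod.natCast_eq_natCast_iff', Nat.mod_eq_of_lt (by omega),
    Nat.mod_eq_of_lt (by omega)] at heq
  have := congrArg (· % (m + 1)) heq
  simp only [Nat.mul_add_mod_self_right, Nat.mul_mod_left] at this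
  rw [Nat.mod_eq_of_lt (by omega)] at this
  omega

/-- A network without protected links: a circulant graph on all nodes in which the nodes of type 2
are independent, together with a Harary graph on the nodes of type 2. -/
lemma exists_isResistant_unprotected {k₁ m d : ℕ} (hm : k₁ + 1 = 2 * m) (hm1 : 1 ≤ m)
    (hn₁ : k₁ + 1 ≤ n₁) (hdn : d < n₂) (h : n₂ * m ≤ n₁) (hpar : n₂ * d % 2 = 0) :
    ∃ g : Design n₁ n₂, g.IsResistant k₁ (k₁ + d) ∧ g.EP.card = 0 ∧
      2 * g.ENP.card ≤ n₁ * (k₁ + 1) + n₂ * (k₁ + d + 1) := by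
  have : NeZero (n₁ + n₂) := ⟨by omega⟩
  have : NeZero n₂ := ⟨by omega⟩
  obtain ⟨π, hπ⟩ := exists_placement h (by omega)
  let ι : ZMod n₂ → Node n₁ n₂ := fun w => Sum.inr ⟨w.val, ZMod.val_lt w⟩
  have hι : Function.Injective ι := fun a b hab => by
    apply ZMod.val_injective
    simpa [ι] using hab
  have hιc : ∀ j : Fin n₂, ι (j.val : ZMod n₂) = Sum.inr j := fun j => by
    simp [ι, ZMod.val_cast_of_lt j.2]
  let E₁ := (circulantLinks (n₁ + n₂) m).image (Sym2.map π)
  let E₂ := (hararyLinks n₂ d).image (Sym2.map ι)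
  have hdisj : Disjoint E₁ E₂ := by
    refine disjoint_left.2 fun l hl hl' => ?_
    obtain ⟨l₁, hl₁, rfl⟩ := mem_image.1 hl
    obtain ⟨l', -, heq⟩ := mem_image.1 hl'
    obtain ⟨x, δ, hδ, rfl⟩ := mem_circulantLinks.1 hl₁
    have hr : ∀ u, π u ∈ Sym2.map ι l' → ∃ j : Fin n₂,
        u = ((j.val * (m + 1) : ℕ) : ZMod (n₁ + n₂)) := fun u hu => by
      obtain ⟨w, -, hw⟩ := Sym2.mem_map.1 hu
      exact ⟨⟨w.val, ZMod.val_lt w⟩, π.injective (by rw [hπ]; exact hw.symm)⟩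
    obtain ⟨i, hi⟩ := hr x (by rw [heq]; simp)
    obtain ⟨j, hj⟩ := hr (x + δ) (by rw [heq]; simp)
    rw [hi] at hj
    exact mul_add_ne_mul h i.2 j.2 hδ.1 hδ.2 hj
  have hcut : ∀ S, (cut E₁ S).card + (cut E₂ S).card ≤ (cut (E₁ ∪ E₂) S).card :=
    fun S => card_cut_add_le hdisj S
  have hmn : 2 * m < n₁ + n₂ := by omega
  have hcut₁ : ∀ S : Finset (Node n₁ n₂), ∀ i ∈ S, ∀ j ∉ S, 2 * m ≤ (cut E₁ S).card :=
    fun S i hi j hj =>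
      (two_mul_le_card_cut_circulantLinks (x := π.symm i) (y := π.symm j) hmn (by simpa using hi)
        (by simpa using hj)).trans (card_cut_image π.injective _ S)
  refine ⟨⟨∅, E₁ ∪ E₂, by simp, by simp, fun l hl => ?_⟩, ?_, by simp, ?_⟩
  · rcases mem_union.1 hl with hl | hl <;> obtain ⟨l', hl', rfl⟩ := mem_image.1 hl
    · rw [Sym2.isDiag_map π.injective]
      exact not_isDiag_of_mem_circulantLinks (by omega) hl'
    · rw [Sym2.isDiag_map hι]
      exact not_isDiag_of_mem_hararyLinks hdn hl'
  · refine isResistant_iff_cut.2 ⟨fun S _ i hi j hj => ?_, fun S _ i j hi hj => ?_⟩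
    · have := hcut₁ S i hi j hj
      have := hcut S
      simp only
      omega
    · have h1 := hcut₁ S _ hi _ hj
      have h2 := hcut S
      have h3 := card_cut_image hι (hararyLinks n₂ d) S
      have h4 := card_cut_image π.injective (circulantLinks (n₁ + n₂) m) S
      have hmem : ∀ a : ℕ, a < n₂ → ((a : ZMod n₂) ∈ univ.filter (fun w => ι w ∈ S) ↔
          ((a * (m + 1) : ℕ) : ZMod (n₁ + n₂)) ∈ univ.filter fun w => π w ∈ S) := fun a ha => by
        have e1 := hιc ⟨a, ha⟩
        have e2 := hπ ⟨a, ha⟩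
        simp only at e1 e2
        rw [mem_filter, mem_filter, e1, e2]
        simp
      simp only
      rcases le_card_cut_hararyLinks hdn hpar (A := univ.filter fun w => ι w ∈ S)
        (x := (i.val : ZMod n₂)) (y := (j.val : ZMod n₂)) (by simpa [hιc] using hi)
        (by simpa [hιc] using hj) with h5 | ⟨h5, a, b, c, e, hab, hbc, hce, hen, halt⟩
      · simp only [E₁, E₂] at *
        omega
      · have hlt : e * (m + 1) < n₁ + n₂ := by
          have := Nat.mul_le_mul_right (m + 1) (Nat.succ_le_of_lt hen)
          rw [Nat.succ_mul, mul_add n₂, mul_one] at this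
          omega
        have hab' := Nat.mul_lt_mul_of_pos_right hab (Nat.succ_pos m)
        have hbc' := Nat.mul_lt_mul_of_pos_right hbc (Nat.succ_pos m)
        have hce' := Nat.mul_lt_mul_of_pos_right hce (Nat.succ_pos m)
        -- Interleaving along `ZMod n₂` becomes interleaving along the whole cycle; the extra
        -- circulant link offsets the missing Harary link.
        rw [hmem a (by omega), hmem b (by omega), hmem c (by omega), hmem e hen] at halt
        have h6 : 2 * m < (cut (circulantLinks (n₁ + n₂) m)
            (univ.filter fun w => π w ∈ S)).card := by
          rcases halt with ⟨h1, h2, h3, h4⟩ | ⟨h1, h2, h3, h4⟩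
          · exact two_mul_lt_card_cut_circulantLinks hm1 hmn hab' hbc' hce' hlt h1 h2 h3 h4
          · rw [← cut_compl]
            refine two_mul_lt_card_cut_circulantLinks hm1 hmn hab' hbc' hce' hlt (mem_compl.2 h1)
              ?_ (mem_compl.2 h3) ?_ <;> rwa [mem_compl, not_not]
        simp only [E₁, E₂] at *
        omega
  · have h1 : E₁.card ≤ (n₁ + n₂) * m := card_image_le.trans (card_circulantLinks_le _ _)
    have h2 : 2 * E₂.card ≤ n₂ * d :=
      (Nat.mul_le_mul_left 2 card_image_le).trans two_mul_card_hararyLinks_le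
    have h3 := card_union_le E₁ E₂
    have h4 : n₁ * (k₁ + 1) + n₂ * (k₁ + d + 1) = 2 * ((n₁ + n₂) * m) + n₂ * d := by
      rw [add_right_comm, hm]; ring
    simp only
    omega

end IoT

/-! ### Optimality and cost bounds -/

namespace IoT

variable {n₁ n₂ : ℕ}

lemma Design.IsOptimal.isSD {k₁ k₂ : ℕ} {cP cNP : ℝ} {g : Design n₁ n₂} (hcNP : 0 < cNP)
    (hg : g.IsOptimal k₁ k₂ cP cNP) : g.IsSD k₁ k₂ g.EP.card := by
  refine ⟨hg.1, rfl, fun g' hr hp => ?_⟩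
  have h := hg.2 g' hr
  rw [Design.cost, Design.cost, hp] at h
  have h' : (g.ENP.card : ℝ) ≤ g'.ENP.card := le_of_mul_le_mul_left (by linarith) hcNP
  exact_mod_cast h'

/-- A competitor with equally many protected links and minimal non-protected ones costs no more than
`g`. -/
lemma Design.IsOptimal.sdOptimal {k₁ k₂ : ℕ} {cP cNP : ℝ} {g : Design n₁ n₂} (hcNP : 0 < cNP)
    (hg : g.IsOptimal k₁ k₂ cP cNP) : SDOptimal n₁ n₂ k₁ k₂ cP cNP g.EP.card := by
  refine ⟨⟨g, hg.isSD hcNP⟩, fun g' hg' => ⟨hg'.1, fun h hh => le_trans ?_ (hg.2 h hh)⟩⟩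
  rw [Design.cost, Design.cost, hg'.2.1]
  have := mul_le_mul_of_nonneg_left (Nat.cast_le (α := ℝ).2 (hg'.2.2 g hg.1 rfl)) hcNP.le
  linarith

/-- Twice the cost of a design, in units of the cost of a non-protected link. -/
lemma Design.cost_eq {cP cNP : ℝ} (hcNP : 0 < cNP) (g : Design n₁ n₂) :
    g.cost cP cNP = cNP / 2 * (2 * (cP / cNP) * g.EP.card + 2 * g.ENP.card) := by
  rw [Design.cost]
  field_simp

lemma Design.cost_le_cost_iff {cP cNP : ℝ} (hcNP : 0 < cNP) (g g' : Design n₁ n₂) :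
    g.cost cP cNP ≤ g'.cost cP cNP ↔
      2 * (cP / cNP) * g.EP.card + 2 * g.ENP.card ≤
        2 * (cP / cNP) * g'.EP.card + 2 * g'.ENP.card := by
  rw [cost_eq hcNP, cost_eq hcNP, mul_le_mul_iff_right₀ (by positivity)]

/-- A design whose cost attains a lower bound is optimal, and then every optimal design has one of
the numbers of protected links for which the bound is attained. -/
lemma sdOptimal_of_bound {k₁ k₂ : ℕ} {cP cNP v : ℝ} {P : ℕ → Prop} (hcNP : 0 < cNP)
    (hv : ∀ g : Design n₁ n₂, g.IsResistant k₁ k₂ →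
      v ≤ 2 * (cP / cNP) * g.EP.card + 2 * g.ENP.card ∧
      (2 * (cP / cNP) * g.EP.card + 2 * g.ENP.card ≤ v → P g.EP.card))
    {g : Design n₁ n₂} (hg : g.IsResistant k₁ k₂)
    (hgv : 2 * (cP / cNP) * g.EP.card + 2 * g.ENP.card ≤ v) :
    SDOptimal n₁ n₂ k₁ k₂ cP cNP g.EP.card ∧
      ∀ g : Design n₁ n₂, g.IsOptimal k₁ k₂ cP cNP → P g.EP.card := by
  have hopt : g.IsOptimal k₁ k₂ cP cNP :=
    ⟨hg, fun g' hg' => (Design.cost_le_cost_iff hcNP g g').2 (hgv.trans (hv g' hg').1)⟩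
  exact ⟨hopt.sdOptimal hcNP, fun g' hg' =>
    (hv g' hg'.1).2 (((Design.cost_le_cost_iff hcNP g' g).1 (hg'.2 g hg)).trans hgv)⟩

section Bounds

variable {E M c₁ c₂ : ℕ} {a b r : ℝ}

/-- The lower bounds of `Design.IsResistant.exists_bounds` for `E` protected and `M / 2`
non-protected links, where `a = k₁ + 1` and `b = k₂ + 1`. -/
structure LinkBounds (n₁ n₂ E M c₁ c₂ : ℕ) (a b : ℝ) : Prop where
  le₁ : c₁ ≤ n₁
  pos₂ : 1 ≤ c₂
  le₂ : c₂ ≤ n₂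
  le_add : n₁ + n₂ ≤ E + c₁ + c₂
  many : 2 ≤ c₂ → c₁ * a + c₂ * b ≤ M
  one : c₂ = 1 → 1 ≤ c₁ → (c₁ + 1) * a ≤ M

lemma LinkBounds.le_add_real (h : LinkBounds n₁ n₂ E M c₁ c₂ a b) :
    (n₁ : ℝ) + n₂ ≤ E + c₁ + c₂ := by exact_mod_cast h.le_add

lemma LinkBounds.cases (h : LinkBounds n₁ n₂ E M c₁ c₂ a b) :
    2 ≤ c₂ ∨ (c₂ = 1 ∧ 1 ≤ c₁) ∨ (c₂ = 1 ∧ c₁ = 0) := by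
  have := h.pos₂
  omega

/-- Here `r > b > a`. For `c₂ ≥ 2` the excess is at least `(r - a) * (n₁ - c₁) + (r - b) * (n₂ -
c₂)`; for `c₂ = 1` the comparison uses `hr`. -/
lemma LinkBounds.bound_unprotected (h : LinkBounds n₁ n₂ E M c₁ c₂ a b) (ha : 2 ≤ a)
    (hab : a + 1 ≤ b) (hn₁ : a ≤ n₁) (hn₂ : b - a + 1 ≤ n₂)
    (hr : b * n₂ - a ≤ r * (n₂ - 1)) :
    n₁ * a + n₂ * b ≤ r * E + M ∧
      (r * E + M ≤ n₁ * a + n₂ * b → E = 0 ∨ E = n₂ - 1 ∨ E = n₁ + n₂ - 1) := by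
  have hb : b < r := by nlinarith
  have h1 : (c₁ : ℝ) ≤ n₁ := by exact_mod_cast h.le₁
  have h2 : (c₂ : ℝ) ≤ n₂ := by exact_mod_cast h.le₂
  have h3 := h.le_add_real
  have h1' := h.le₁
  have h2' := h.le₂
  have h3' := h.le_add
  have p1 : 0 ≤ (r - a) * (n₁ - c₁) := mul_nonneg (by linarith) (by linarith)
  have p2 : 0 ≤ (r - b) * (n₂ - c₂) := mul_nonneg (by linarith) (by linarith)
  have p3 : 0 ≤ r * (E + c₁ + c₂ - n₁ - n₂) := mul_nonneg (by linarith) (by linarith)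
  have q1 : (r - a) * (n₁ - c₁) ≤ 0 → n₁ ≤ c₁ := fun h => by
    have := nonpos_of_mul_nonpos_right h (by linarith)
    exact_mod_cast (by linarith : (n₁ : ℝ) ≤ c₁)
  have q2 : (r - b) * (n₂ - c₂) ≤ 0 → n₂ ≤ c₂ := fun h => by
    have := nonpos_of_mul_nonpos_right h (by linarith)
    exact_mod_cast (by linarith : (n₂ : ℝ) ≤ c₂)
  have q3 : r * (E + c₁ + c₂ - n₁ - n₂) ≤ 0 → E + c₁ + c₂ ≤ n₁ + n₂ := fun h => by
    have := nonpos_of_mul_nonpos_right h (by linarith)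
    exact_mod_cast (by linarith : (E : ℝ) + c₁ + c₂ ≤ n₁ + n₂)
  rcases h.cases with hc | ⟨hc, hc'⟩ | ⟨hc, hc'⟩
  · have hM := h.many hc
    refine ⟨by linarith, fun hX => ?_⟩
    have := q1 (by linarith)
    have := q2 (by linarith)
    have := q3 (by linarith)
    omega
  · have hM := h.one hc hc'
    subst hc
    push_cast at p2 p3 hM
    refine ⟨by linarith, fun hX => ?_⟩
    have := q1 (by linarith)
    have := q3 (by push_cast; linarith)
    omega
  · subst hc hc'
    have hM : (0 : ℝ) ≤ M := M.cast_nonneg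
    have hn : (a + 1) * n₁ ≤ r * n₁ := by gcongr; linarith
    push_cast at p3
    refine ⟨by linarith, fun hX => ?_⟩
    have := q3 (by push_cast; linarith)
    omega

/-- `hr₂` makes `c₂ ≥ 2` strictly worse than `c₂ = 1`, and `hr₁` makes `c₁ = n₁` no worse than `c₁ =
0`. -/
lemma LinkBounds.bound_partial (h : LinkBounds n₁ n₂ E M c₁ c₂ a b) (ha : 2 ≤ a)
    (hab : a + 1 ≤ b) (hr₁ : a * n₁ + a ≤ r * n₁)
    (hr₂ : r * (n₂ - 1) < b * n₂ - a) :
    r * (n₂ - 1) + (n₁ + 1) * a ≤ r * E + M ∧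
      (r * E + M ≤ r * (n₂ - 1) + (n₁ + 1) * a → E = 0 ∨ E = n₂ - 1 ∨ E = n₁ + n₂ - 1) := by
  have har : a < r := by nlinarith
  have h1 : (c₁ : ℝ) ≤ n₁ := by exact_mod_cast h.le₁
  have h2 : (c₂ : ℝ) ≤ n₂ := by exact_mod_cast h.le₂
  have h3 := h.le_add_real
  have h1' := h.le₁
  have h2' := h.le₂
  have h3' := h.le_add
  have p1 : 0 ≤ (r - a) * (n₁ - c₁) := mul_nonneg (by linarith) (by linarith)
  have p3 : 0 ≤ r * (E + c₁ + c₂ - n₁ - n₂) := mul_nonneg (by linarith) (by linarith)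
  have q1 : (r - a) * (n₁ - c₁) ≤ 0 → n₁ ≤ c₁ := fun h => by
    have := nonpos_of_mul_nonpos_right h (by linarith)
    exact_mod_cast (by linarith : (n₁ : ℝ) ≤ c₁)
  have q3 : r * (E + c₁ + c₂ - n₁ - n₂) ≤ 0 → E + c₁ + c₂ ≤ n₁ + n₂ := fun h => by
    have := nonpos_of_mul_nonpos_right h (by linarith)
    exact_mod_cast (by linarith : (E : ℝ) + c₁ + c₂ ≤ n₁ + n₂)
  rcases h.cases with hc | ⟨hc, hc'⟩ | ⟨hc, hc'⟩
  · have hM := h.many hc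
    have hc2 : (2 : ℝ) ≤ c₂ := by exact_mod_cast hc
    -- `b + (b - a) / (c - 1)` decreases in `c`, so the strict inequality passes from `n₂` to `c₂`.
    have hlt : r * (c₂ - 1) < c₂ * b - a := by
      have e1 := mul_lt_mul_of_pos_right hr₂ (by linarith : (0 : ℝ) < c₂ - 1)
      have e2 : 0 ≤ (b - a) * (n₂ - c₂) := mul_nonneg (by linarith) (by linarith)
      refine lt_of_mul_lt_mul_right (a := (n₂ : ℝ) - 1) ?_ (by linarith)
      nlinarith
    have hX : r * (n₂ - 1) + (n₁ + 1) * a < r * E + M := by linarith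
    exact ⟨hX.le, fun h => absurd h (by linarith)⟩
  · have hM := h.one hc hc'
    subst hc
    push_cast at p3 hM
    refine ⟨by linarith, fun hX => ?_⟩
    have := q1 (by linarith)
    have := q3 (by push_cast; linarith)
    omega
  · subst hc hc'
    have hM : (0 : ℝ) ≤ M := M.cast_nonneg
    push_cast at p3
    refine ⟨by linarith, fun hX => ?_⟩
    have := q3 (by push_cast; linarith)
    omega

/-- From `a ≤ n₁` follows `r ≤ a + 1 ≤ b`, and `a + a / c` decreases in `c`, so two or more classes
always cost more than one. -/
lemma LinkBounds.bound_tree (h : LinkBounds n₁ n₂ E M c₁ c₂ a b) (ha : 2 ≤ a)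
    (hab : a + 1 ≤ b) (hn₁ : a ≤ n₁) (hr₀ : 0 < r) (hr₁ : r * n₁ < a * n₁ + a) :
    r * (n₁ + n₂ - 1) ≤ r * E + M ∧
      (r * E + M ≤ r * (n₁ + n₂ - 1) → E = 0 ∨ E = n₂ - 1 ∨ E = n₁ + n₂ - 1) := by
  have h1 : (c₁ : ℝ) ≤ n₁ := by exact_mod_cast h.le₁
  have h3 := h.le_add_real
  have h3' := h.le_add
  have hc0 : (0 : ℝ) ≤ c₁ := c₁.cast_nonneg
  have hrb : r ≤ b := by
    refine le_of_mul_le_mul_right (a := (n₁ : ℝ)) ?_ (by linarith)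
    nlinarith
  have p3 : 0 ≤ r * (E + c₁ + c₂ - n₁ - n₂) := mul_nonneg (by linarith) (by linarith)
  have q3 : r * (E + c₁ + c₂ - n₁ - n₂) ≤ 0 → E + c₁ + c₂ ≤ n₁ + n₂ := fun h => by
    have := nonpos_of_mul_nonpos_right h (by linarith)
    exact_mod_cast (by linarith : (E : ℝ) + c₁ + c₂ ≤ n₁ + n₂)
  have hle : r * c₁ ≤ (c₁ + 1) * a := by
    refine le_of_mul_le_mul_right (a := (n₁ : ℝ)) ?_ (by linarith)
    have e1 := mul_le_mul_of_nonneg_right hr₁.le hc0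
    have e2 : 0 ≤ a * (n₁ - c₁) := mul_nonneg (by linarith) (by linarith)
    linarith
  rcases h.cases with hc | ⟨hc, hc'⟩ | ⟨hc, hc'⟩
  · have hM := h.many hc
    have hc2 : (2 : ℝ) ≤ c₂ := by exact_mod_cast hc
    have e1 : 0 ≤ (b - r) * (c₂ - 1) := mul_nonneg (by linarith) (by linarith)
    have hX : r * (n₁ + n₂ - 1) < r * E + M := by linarith
    exact ⟨hX.le, fun h => absurd h (by linarith)⟩
  · have hM := h.one hc hc'
    have hc1 : (1 : ℝ) ≤ c₁ := by exact_mod_cast hc'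
    have hlt : r * c₁ < (c₁ + 1) * a := by
      refine lt_of_mul_lt_mul_right (a := (n₁ : ℝ)) ?_ (by linarith)
      have e1 := mul_lt_mul_of_pos_right hr₁ (by linarith : (0 : ℝ) < c₁)
      have e2 : 0 ≤ a * (n₁ - c₁) := mul_nonneg (by linarith) (by linarith)
      linarith
    subst hc
    push_cast at p3
    have hX : r * (n₁ + n₂ - 1) < r * E + M := by linarith
    exact ⟨hX.le, fun h => absurd h (by linarith)⟩
  · subst hc hc'
    have hM : (0 : ℝ) ≤ M := M.cast_nonneg
    push_cast at p3
    refine ⟨by linarith, fun hX => ?_⟩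
    have := q3 (by push_cast; linarith)
    omega

/-- If both threat levels agree, then only the number of components matters. -/
lemma LinkBounds.exists_uniform (h : LinkBounds n₁ n₂ E M c₁ c₂ a a) :
    ∃ c : ℕ, c ≤ n₁ + n₂ ∧ n₁ + n₂ ≤ E + c ∧ (2 ≤ c ∧ c * a ≤ M ∨ c = 1) := by
  have h1 := h.le₁
  have h2 := h.le₂
  have h3 := h.le_add
  refine ⟨c₁ + c₂, by omega, by omega, ?_⟩
  rcases h.cases with hc | ⟨hc, hc'⟩ | ⟨hc, hc'⟩
  · refine Or.inl ⟨by omega, ?_⟩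
    have := h.many hc
    push_cast
    linarith
  · refine Or.inl ⟨by omega, ?_⟩
    have := h.one hc hc'
    rw [hc]
    push_cast
    exact this
  · exact Or.inr (by omega)

lemma LinkBounds.bound_unprotected_uniform (h : LinkBounds n₁ n₂ E M c₁ c₂ a a)
    (ha : 0 < a) (hn : 2 ≤ n₁ + n₂) (hr : a * (n₁ + n₂) ≤ r * (n₁ + n₂ - 1)) :
    a * (n₁ + n₂) ≤ r * E + M ∧
      (r * E + M ≤ a * (n₁ + n₂) → E = 0 ∨ E = n₁ + n₂ - 1) := by
  obtain ⟨c, hc, hE, hcase⟩ := h.exists_uniform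
  have hn' : (2 : ℝ) ≤ n₁ + n₂ := by exact_mod_cast hn
  have hc' : (c : ℝ) ≤ n₁ + n₂ := by exact_mod_cast hc
  have hE' : (n₁ : ℝ) + n₂ ≤ E + c := by exact_mod_cast hE
  have har : a < r := by nlinarith
  have p1 : 0 ≤ (r - a) * (n₁ + n₂ - c) := mul_nonneg (by linarith) (by linarith)
  have p3 : 0 ≤ r * (E + c - n₁ - n₂) := mul_nonneg (by linarith) (by linarith)
  have q1 : (r - a) * (n₁ + n₂ - c) ≤ 0 → n₁ + n₂ ≤ c := fun h => by
    have := nonpos_of_mul_nonpos_right h (by linarith)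
    exact_mod_cast (by linarith : (n₁ : ℝ) + n₂ ≤ c)
  have q3 : r * (E + c - n₁ - n₂) ≤ 0 → E + c ≤ n₁ + n₂ := fun h => by
    have := nonpos_of_mul_nonpos_right h (by linarith)
    exact_mod_cast (by linarith : (E : ℝ) + c ≤ n₁ + n₂)
  rcases hcase with ⟨-, hM⟩ | rfl
  · refine ⟨by linarith, fun hX => ?_⟩
    have := q1 (by linarith)
    have := q3 (by linarith)
    omega
  · have hM : (0 : ℝ) ≤ M := M.cast_nonneg
    push_cast at p3
    refine ⟨by linarith, fun hX => ?_⟩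
    have := q3 (by push_cast; linarith)
    omega

lemma LinkBounds.bound_tree_uniform (h : LinkBounds n₁ n₂ E M c₁ c₂ a a)
    (ha : 0 < a) (hn : 2 ≤ n₁ + n₂) (hr₀ : 0 < r) (hr : r * (n₁ + n₂ - 1) < a * (n₁ + n₂)) :
    r * (n₁ + n₂ - 1) ≤ r * E + M ∧
      (r * E + M ≤ r * (n₁ + n₂ - 1) → E = 0 ∨ E = n₁ + n₂ - 1) := by
  obtain ⟨c, hc, hE, hcase⟩ := h.exists_uniform
  have hn' : (2 : ℝ) ≤ n₁ + n₂ := by exact_mod_cast hn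
  have hc' : (c : ℝ) ≤ n₁ + n₂ := by exact_mod_cast hc
  have hE' : (n₁ : ℝ) + n₂ ≤ E + c := by exact_mod_cast hE
  have p3 : 0 ≤ r * (E + c - n₁ - n₂) := mul_nonneg (by linarith) (by linarith)
  have q3 : r * (E + c - n₁ - n₂) ≤ 0 → E + c ≤ n₁ + n₂ := fun h => by
    have := nonpos_of_mul_nonpos_right h (by linarith)
    exact_mod_cast (by linarith : (E : ℝ) + c ≤ n₁ + n₂)
  rcases hcase with ⟨h2, hM⟩ | rfl
  · have h2' : (2 : ℝ) ≤ c := by exact_mod_cast h2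
    -- `a + a / (c - 1)` decreases in `c`, so `hr` passes from `n₁ + n₂` to `c`.
    have hlt : r * (c - 1) < c * a := by
      refine lt_of_mul_lt_mul_right (a := (n₁ : ℝ) + n₂ - 1) ?_ (by linarith)
      have e1 := mul_lt_mul_of_pos_right hr (by linarith : (0 : ℝ) < c - 1)
      have e2 : 0 ≤ a * (n₁ + n₂ - c) := mul_nonneg (by linarith) (by linarith)
      linarith
    have hX : r * (n₁ + n₂ - 1) < r * E + M := by linarith
    exact ⟨hX.le, fun h => absurd h (by linarith)⟩
  · have hM : (0 : ℝ) ≤ M := M.cast_nonneg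
    push_cast at p3
    refine ⟨by linarith, fun hX => ?_⟩
    have := q3 (by push_cast; linarith)
    omega

end Bounds

lemma Design.IsResistant.exists_linkBounds {k₁ k₂ : ℕ} {g : Design n₁ n₂}
    (hg : g.IsResistant k₁ k₂) (hn₂ : 1 ≤ n₂) :
    ∃ c₁ c₂ : ℕ,
      LinkBounds n₁ n₂ g.EP.card (2 * g.ENP.card) c₁ c₂ ((k₁ : ℝ) + 1) ((k₂ : ℝ) + 1) := by
  obtain ⟨c₁, c₂, h1, h2, h3, h4, h5, h6⟩ := hg.exists_bounds hn₂
  exact ⟨c₁, c₂, h1, h2, h3, h4, fun h => by exact_mod_cast h5 h,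
    fun h h' => by exact_mod_cast h6 h h'⟩

end IoT

/-! ### Thresholds and the final case distinction -/

namespace IoT

variable {n₁ n₂ k₁ k₂ : ℕ}

lemma regime_iff (hk : k₁ ≤ k₂) (hn₁ : k₁ + 1 ≤ n₁) :
    (RegimeI n₁ n₂ k₁ k₂ ↔ k₁ < k₂) ∧ (RegimeII n₁ n₂ k₁ k₂ ↔ k₁ = k₂) := by
  have hn : (k₁ : ℝ) + 1 ≤ n₁ := by exact_mod_cast hn₁
  have h0 : (0 : ℝ) ≤ n₂ := n₂.cast_nonneg
  have hk0 : (0 : ℝ) ≤ k₁ := k₁.cast_nonneg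
  rw [RegimeI, RegimeII]
  rcases hk.eq_or_lt with rfl | hlt
  · simp
    linarith
  · have hk' : (k₁ : ℝ) + 1 ≤ k₂ := by exact_mod_cast hlt
    have h : 1 + (k₁ : ℝ) - ((n₁ : ℝ) + n₂) * ((k₂ : ℝ) - k₁) ≤ 0 := by nlinarith
    exact ⟨iff_of_true h hlt, iff_of_false (not_lt.2 h) hlt.ne⟩

/-- The quotient `(k₁ + 1) / n₁` lies in `(0, 1]`, and `k₁ + 2 ≤ k₂ + 1`. -/
lemma thresholds_strict (hlt : k₁ < k₂) (hk1 : 1 ≤ k₁) (hn₁ : k₁ + 1 ≤ n₁) (hn₂ : 2 ≤ n₂) :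
    2 < (k₁ : ℝ) + 1 + ((k₁ : ℝ) + 1) / n₁ ∧
      (k₁ : ℝ) + 1 + ((k₁ : ℝ) + 1) / n₁ <
        (k₂ : ℝ) + 1 + ((k₂ : ℝ) - k₁) / ((n₂ : ℝ) - 1) := by
  have e1 : (k₁ : ℝ) + 1 ≤ k₂ := by exact_mod_cast hlt
  have e2 : (1 : ℝ) ≤ k₁ := by exact_mod_cast hk1
  have e3 : (k₁ : ℝ) + 1 ≤ n₁ := by exact_mod_cast hn₁
  have e4 : (2 : ℝ) ≤ n₂ := by exact_mod_cast hn₂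
  have e5 : 0 < ((k₁ : ℝ) + 1) / n₁ := div_pos (by linarith) (by linarith)
  have e6 : ((k₁ : ℝ) + 1) / n₁ ≤ 1 := (div_le_one (by linarith)).2 e3
  have e7 : 0 < ((k₂ : ℝ) - k₁) / ((n₂ : ℝ) - 1) := div_pos (by linarith) (by linarith)
  exact ⟨by linarith, by linarith⟩

section Strategies

variable {m : ℕ} {cP cNP : ℝ}

/-- Optimal numbers of protected links in Regime I. -/
lemma strategies_of_lt (hcNP : 0 < cNP) (hcP : cNP ≤ cP) (hlt : k₁ < k₂) (hm : k₁ + 1 = 2 * m)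
    (hm1 : 1 ≤ m) (hn₁ : k₁ + 1 ≤ n₁) (hn₂ : k₂ + 1 ≤ n₂ + k₁) (hn : n₂ * m ≤ n₁)
    (hpar : n₂ * (k₂ - k₁) % 2 = 0) :
    ((k₂ : ℝ) + 1 + ((k₂ : ℝ) - k₁) / ((n₂ : ℝ) - 1) ≤ 2 * (cP / cNP) →
      SDOptimal n₁ n₂ k₁ k₂ cP cNP 0) ∧
    ((k₁ : ℝ) + 1 + ((k₁ : ℝ) + 1) / n₁ ≤ 2 * (cP / cNP) →
      2 * (cP / cNP) < (k₂ : ℝ) + 1 + ((k₂ : ℝ) - k₁) / ((n₂ : ℝ) - 1) →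
      SDOptimal n₁ n₂ k₁ k₂ cP cNP (n₂ - 1)) ∧
    (2 * (cP / cNP) < (k₁ : ℝ) + 1 + ((k₁ : ℝ) + 1) / n₁ →
      SDOptimal n₁ n₂ k₁ k₂ cP cNP (n₁ + n₂ - 1)) ∧
    ∀ g : Design n₁ n₂, g.IsOptimal k₁ k₂ cP cNP →
      g.EP.card = 0 ∨ g.EP.card = n₂ - 1 ∨ g.EP.card = n₁ + n₂ - 1 := by
  have hn₂2 : 2 ≤ n₂ := by omega
  have ha : (2 : ℝ) ≤ (k₁ : ℝ) + 1 := by exact_mod_cast (by omega : 2 ≤ k₁ + 1)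
  have hab : (k₁ : ℝ) + 1 + 1 ≤ (k₂ : ℝ) + 1 := by exact_mod_cast (by omega : k₁ + 1 + 1 ≤ k₂ + 1)
  have hn₁R : (k₁ : ℝ) + 1 ≤ n₁ := by exact_mod_cast hn₁
  have hn₂R : (k₂ : ℝ) + 1 - (k₁ + 1) + 1 ≤ n₂ := by
    have : (k₂ : ℝ) + 1 ≤ n₂ + k₁ := by exact_mod_cast hn₂
    linarith
  have hr₀ : 0 < 2 * (cP / cNP) := by have := hcNP.trans_le hcP; positivity
  have hT₁ : (k₁ : ℝ) + 1 + ((k₁ : ℝ) + 1) / n₁ ≤ 2 * (cP / cNP) ↔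
      ((k₁ : ℝ) + 1) * n₁ + (k₁ + 1) ≤ 2 * (cP / cNP) * n₁ := by
    rw [← mul_le_mul_iff_left₀ (by linarith : (0 : ℝ) < n₁), add_mul ((k₁ : ℝ) + 1),
      div_mul_cancel₀ _ (by linarith : (n₁ : ℝ) ≠ 0)]
  -- Clearing the denominator uses `(k₂ + 1)(n₂ - 1) + (k₂ - k₁) = (k₂ + 1) n₂ - (k₁ + 1)`.
  have hT₂ : (k₂ : ℝ) + 1 + ((k₂ : ℝ) - k₁) / ((n₂ : ℝ) - 1) ≤ 2 * (cP / cNP) ↔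
      ((k₂ : ℝ) + 1) * n₂ - (k₁ + 1) ≤ 2 * (cP / cNP) * (n₂ - 1) := by
    have hpos : (0 : ℝ) < (n₂ : ℝ) - 1 := by linarith
    rw [← mul_le_mul_iff_left₀ hpos, add_mul ((k₂ : ℝ) + 1), div_mul_cancel₀ _ hpos.ne']
    constructor <;> intro h <;> linarith
  have case₀ : (k₂ : ℝ) + 1 + ((k₂ : ℝ) - k₁) / ((n₂ : ℝ) - 1) ≤ 2 * (cP / cNP) →
      SDOptimal n₁ n₂ k₁ k₂ cP cNP 0 ∧ ∀ g : Design n₁ n₂, g.IsOptimal k₁ k₂ cP cNP →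
        g.EP.card = 0 ∨ g.EP.card = n₂ - 1 ∨ g.EP.card = n₁ + n₂ - 1 := fun h => by
    obtain ⟨g, hg, hE, hN⟩ := exists_isResistant_unprotected (n₁ := n₁) (n₂ := n₂) (d := k₂ - k₁)
      hm hm1 hn₁ (by omega) hn hpar
    rw [Nat.add_sub_cancel' hlt.le] at hg hN
    have hN' : 2 * (g.ENP.card : ℝ) ≤ n₁ * ((k₁ : ℝ) + 1) + n₂ * ((k₂ : ℝ) + 1) := by
      exact_mod_cast hN
    rw [← hE]
    refine sdOptimal_of_bound
      (P := fun p => p = g.EP.card ∨ p = n₂ - 1 ∨ p = n₁ + n₂ - 1) hcNP (fun g' hg' => ?_) hg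
      (v := n₁ * ((k₁ : ℝ) + 1) + n₂ * ((k₂ : ℝ) + 1)) (by rw [hE]; push_cast; linarith)
    obtain ⟨c₁, c₂, hb⟩ := hg'.exists_linkBounds (by omega)
    simpa [hE] using hb.bound_unprotected ha hab hn₁R hn₂R (hT₂.1 h)
  have case₁ : (k₁ : ℝ) + 1 + ((k₁ : ℝ) + 1) / n₁ ≤ 2 * (cP / cNP) →
      2 * (cP / cNP) < (k₂ : ℝ) + 1 + ((k₂ : ℝ) - k₁) / ((n₂ : ℝ) - 1) →
      SDOptimal n₁ n₂ k₁ k₂ cP cNP (n₂ - 1) ∧ ∀ g : Design n₁ n₂, g.IsOptimal k₁ k₂ cP cNP →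
        g.EP.card = 0 ∨ g.EP.card = n₂ - 1 ∨ g.EP.card = n₁ + n₂ - 1 := fun h h' => by
    obtain ⟨g, hg, hE, hN⟩ := exists_isResistant_partial (n₁ := n₁) (n₂ := n₂) k₂ hm hn₁ (by omega)
    have hN' : 2 * (g.ENP.card : ℝ) ≤ ((n₁ : ℝ) + 1) * ((k₁ : ℝ) + 1) := by exact_mod_cast hN
    have hE' : (g.EP.card : ℝ) = n₂ - 1 := by rw [hE, Nat.cast_pred (by omega)]
    rw [← hE]
    refine sdOptimal_of_bound
      (P := fun p => p = 0 ∨ p = g.EP.card ∨ p = n₁ + n₂ - 1) hcNP (fun g' hg' => ?_) hg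
      (v := 2 * (cP / cNP) * (n₂ - 1) + (n₁ + 1) * ((k₁ : ℝ) + 1)) (by rw [hE']; linarith)
    obtain ⟨c₁, c₂, hb⟩ := hg'.exists_linkBounds (by omega)
    have := hb.bound_partial ha hab (hT₁.1 h) (not_le.1 (mt hT₂.2 (not_le.2 h')))
    simpa [hE] using this
  have case₂ : 2 * (cP / cNP) < (k₁ : ℝ) + 1 + ((k₁ : ℝ) + 1) / n₁ →
      SDOptimal n₁ n₂ k₁ k₂ cP cNP (n₁ + n₂ - 1) ∧ ∀ g : Design n₁ n₂, g.IsOptimal k₁ k₂ cP cNP →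
        g.EP.card = 0 ∨ g.EP.card = n₂ - 1 ∨ g.EP.card = n₁ + n₂ - 1 := fun h => by
    obtain ⟨g, hg, hE, hN⟩ := exists_isResistant_tree (n₁ := n₁) (n₂ := n₂) k₁ k₂ (by omega)
    have hE' : (g.EP.card : ℝ) = n₁ + n₂ - 1 := by
      rw [hE, Nat.cast_pred (by omega), Nat.cast_add]
    rw [← hE]
    refine sdOptimal_of_bound
      (P := fun p => p = 0 ∨ p = n₂ - 1 ∨ p = g.EP.card) hcNP (fun g' hg' => ?_) hg
      (v := 2 * (cP / cNP) * (n₁ + n₂ - 1)) (by rw [hE', hN]; simp)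
    obtain ⟨c₁, c₂, hb⟩ := hg'.exists_linkBounds (by omega)
    have := hb.bound_tree ha hab hn₁R hr₀ (not_le.1 (mt hT₁.2 (not_le.2 h)))
    simpa [hE] using this
  refine ⟨fun h => (case₀ h).1, fun h h' => (case₁ h h').1, fun h => (case₂ h).1, ?_⟩
  rcases le_or_gt ((k₂ : ℝ) + 1 + ((k₂ : ℝ) - k₁) / ((n₂ : ℝ) - 1)) (2 * (cP / cNP)) with h | h
  · exact (case₀ h).2
  rcases le_or_gt ((k₁ : ℝ) + 1 + ((k₁ : ℝ) + 1) / n₁) (2 * (cP / cNP)) with h' | h'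
  exacts [(case₁ h' h).2, (case₂ h').2]

/-- Optimal numbers of protected links in Regime II. -/
lemma strategies_of_eq (hcNP : 0 < cNP) (hcP : cNP ≤ cP) (hm : k₁ + 1 = 2 * m)
    (hm1 : 1 ≤ m) (hn₁ : k₁ + 1 ≤ n₁) (hn₂ : 1 ≤ n₂) (hn : n₂ * m ≤ n₁) :
    2 < ((n₁ : ℝ) * (k₁ + 1) + (n₂ : ℝ) * (k₁ + 1)) / ((n₁ : ℝ) + n₂ - 1) ∧
    (((n₁ : ℝ) * (k₁ + 1) + (n₂ : ℝ) * (k₁ + 1)) / ((n₁ : ℝ) + n₂ - 1) ≤ 2 * (cP / cNP) →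
      SDOptimal n₁ n₂ k₁ k₁ cP cNP 0) ∧
    (2 * (cP / cNP) < ((n₁ : ℝ) * (k₁ + 1) + (n₂ : ℝ) * (k₁ + 1)) / ((n₁ : ℝ) + n₂ - 1) →
      SDOptimal n₁ n₂ k₁ k₁ cP cNP (n₁ + n₂ - 1)) ∧
    ∀ g : Design n₁ n₂, g.IsOptimal k₁ k₁ cP cNP →
      g.EP.card = 0 ∨ g.EP.card = n₁ + n₂ - 1 := by
  have ha : (2 : ℝ) ≤ (k₁ : ℝ) + 1 := by exact_mod_cast (by omega : 2 ≤ k₁ + 1)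
  have ha' : (0 : ℝ) < (k₁ : ℝ) + 1 := by linarith
  have hn2 : 2 ≤ n₁ + n₂ := by omega
  have hn2R : (2 : ℝ) ≤ n₁ + n₂ := by exact_mod_cast hn2
  have hpos : (0 : ℝ) < (n₁ : ℝ) + n₂ - 1 := by linarith
  have hr₀ : 0 < 2 * (cP / cNP) := by have := hcNP.trans_le hcP; positivity
  have hsum : (n₁ : ℝ) * (k₁ + 1) + (n₂ : ℝ) * (k₁ + 1) = (k₁ + 1) * (n₁ + n₂) := by ring
  rw [hsum]
  have case₀ : ((k₁ : ℝ) + 1) * (n₁ + n₂) / ((n₁ : ℝ) + n₂ - 1) ≤ 2 * (cP / cNP) →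
      SDOptimal n₁ n₂ k₁ k₁ cP cNP 0 ∧ ∀ g : Design n₁ n₂, g.IsOptimal k₁ k₁ cP cNP →
        g.EP.card = 0 ∨ g.EP.card = n₁ + n₂ - 1 := fun h => by
    obtain ⟨g, hg, hE, hN⟩ := exists_isResistant_unprotected (n₁ := n₁) (n₂ := n₂) (d := 0)
      hm hm1 hn₁ (by omega) hn (by simp)
    rw [add_zero] at hg hN
    have hN' : 2 * (g.ENP.card : ℝ) ≤ n₁ * ((k₁ : ℝ) + 1) + n₂ * ((k₁ : ℝ) + 1) := by
      exact_mod_cast hN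
    rw [← hE]
    refine sdOptimal_of_bound
      (P := fun p => p = g.EP.card ∨ p = n₁ + n₂ - 1) hcNP (fun g' hg' => ?_) hg
      (v := ((k₁ : ℝ) + 1) * (n₁ + n₂)) (by rw [hE]; push_cast; linarith)
    obtain ⟨c₁, c₂, hb⟩ := hg'.exists_linkBounds hn₂
    simpa [hE] using hb.bound_unprotected_uniform ha' hn2 ((div_le_iff₀ hpos).1 h)
  have case₁ : 2 * (cP / cNP) < ((k₁ : ℝ) + 1) * (n₁ + n₂) / ((n₁ : ℝ) + n₂ - 1) →
      SDOptimal n₁ n₂ k₁ k₁ cP cNP (n₁ + n₂ - 1) ∧ ∀ g : Design n₁ n₂, g.IsOptimal k₁ k₁ cP cNP →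
        g.EP.card = 0 ∨ g.EP.card = n₁ + n₂ - 1 := fun h => by
    obtain ⟨g, hg, hE, hN⟩ := exists_isResistant_tree (n₁ := n₁) (n₂ := n₂) k₁ k₁ hn₂
    have hE' : (g.EP.card : ℝ) = n₁ + n₂ - 1 := by
      rw [hE, Nat.cast_pred (by omega), Nat.cast_add]
    rw [← hE]
    refine sdOptimal_of_bound
      (P := fun p => p = 0 ∨ p = g.EP.card) hcNP (fun g' hg' => ?_) hg
      (v := 2 * (cP / cNP) * (n₁ + n₂ - 1)) (by rw [hE', hN]; simp)
    obtain ⟨c₁, c₂, hb⟩ := hg'.exists_linkBounds hn₂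
    simpa [hE] using hb.bound_tree_uniform ha' hn2 hr₀ ((lt_div_iff₀ hpos).1 h)
  refine ⟨?_, fun h => (case₀ h).1, fun h => (case₁ h).1, ?_⟩
  · rw [lt_div_iff₀ hpos]
    nlinarith
  · rcases le_or_gt (((k₁ : ℝ) + 1) * (n₁ + n₂) / ((n₁ : ℝ) + n₂ - 1)) (2 * (cP / cNP)) with h | h
    exacts [(case₀ h).2, (case₁ h).2]

end Strategies

end IoT

theorem corollary3 (n₁ n₂ k₁ k₂ : ℕ) (cP cNP : ℝ)
    (hcNP : 0 < cNP) (hcP : cNP ≤ cP)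
    (hk : k₁ ≤ k₂)
    (hn₁ : k₁ + 1 ≤ n₁)
    (hn₂ : (k₂ : ℤ) - k₁ + 1 ≤ n₂)
    (hn : (n₂ : ℝ) * (((k₁ : ℝ) + 1) / 2) ≤ n₁)
    (hk₁ : k₁ % 2 = 1)
    (hpar : (n₂ * (k₂ + 1)) % 2 = 0) :
    -- the two regimes are told apart by the threat levels
    (IoT.RegimeI n₁ n₂ k₁ k₂ ↔ k₁ < k₂) ∧
    (IoT.RegimeII n₁ n₂ k₁ k₂ ↔ k₁ = k₂) ∧
    -- strategies of Regime I
    (k₁ < k₂ →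
      (2 < (k₁ : ℝ) + 1 + ((k₁ : ℝ) + 1) / n₁ ∧
        (k₁ : ℝ) + 1 + ((k₁ : ℝ) + 1) / n₁ <
          (k₂ : ℝ) + 1 + ((k₂ : ℝ) - k₁) / ((n₂ : ℝ) - 1)) ∧
      ((k₂ : ℝ) + 1 + ((k₂ : ℝ) - k₁) / ((n₂ : ℝ) - 1) ≤ 2 * (cP / cNP) →
        IoT.SDOptimal n₁ n₂ k₁ k₂ cP cNP 0) ∧
      ((k₁ : ℝ) + 1 + ((k₁ : ℝ) + 1) / n₁ ≤ 2 * (cP / cNP) →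
        2 * (cP / cNP) < (k₂ : ℝ) + 1 + ((k₂ : ℝ) - k₁) / ((n₂ : ℝ) - 1) →
        IoT.SDOptimal n₁ n₂ k₁ k₂ cP cNP (n₂ - 1)) ∧
      (2 * (cP / cNP) < (k₁ : ℝ) + 1 + ((k₁ : ℝ) + 1) / n₁ →
        IoT.SDOptimal n₁ n₂ k₁ k₂ cP cNP (n₁ + n₂ - 1)) ∧
      (∀ g : IoT.Design n₁ n₂, g.IsOptimal k₁ k₂ cP cNP →
        g.IsSD k₁ k₂ 0 ∨ g.IsSD k₁ k₂ (n₂ - 1) ∨ g.IsSD k₁ k₂ (n₁ + n₂ - 1))) ∧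
    -- strategies of Regime II
    (k₁ = k₂ →
      (1 + (k₁ : ℝ)) / (1 + (k₁ : ℝ) - (n₁ : ℝ) * ((k₂ : ℝ) - k₁)) ≤ n₂ ∧
      2 < ((n₁ : ℝ) * (k₁ + 1) + (n₂ : ℝ) * (k₂ + 1)) / ((n₁ : ℝ) + n₂ - 1) ∧
      (((n₁ : ℝ) * (k₁ + 1) + (n₂ : ℝ) * (k₂ + 1)) / ((n₁ : ℝ) + n₂ - 1) ≤ 2 * (cP / cNP) →
        IoT.SDOptimal n₁ n₂ k₁ k₂ cP cNP 0) ∧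
      (2 * (cP / cNP) < ((n₁ : ℝ) * (k₁ + 1) + (n₂ : ℝ) * (k₂ + 1)) / ((n₁ : ℝ) + n₂ - 1) →
        IoT.SDOptimal n₁ n₂ k₁ k₂ cP cNP (n₁ + n₂ - 1)) ∧
      (∀ g : IoT.Design n₁ n₂, g.IsOptimal k₁ k₂ cP cNP →
        g.IsSD k₁ k₂ 0 ∨ g.IsSD k₁ k₂ (n₁ + n₂ - 1)) ∧
      (2 ≤ n₂ → ∀ g : IoT.Design n₁ n₂, g.IsSD k₁ k₂ (n₂ - 1) →
        ¬ g.IsOptimal k₁ k₂ cP cNP)) := by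
  obtain ⟨m, hm⟩ : ∃ m, k₁ + 1 = 2 * m := ⟨(k₁ + 1) / 2, by omega⟩
  have hm1 : 1 ≤ m := by omega
  have hnm : n₂ * m ≤ n₁ := by
    have hmR : (k₁ : ℝ) + 1 = 2 * m := by exact_mod_cast hm
    rw [hmR, mul_div_cancel_left₀ _ two_ne_zero] at hn
    exact_mod_cast hn
  -- As `k₁ + 1` is even, `k₂ + 1` and the Harary degree `k₂ - k₁` have the same parity.
  have hparity : n₂ * (k₂ - k₁) % 2 = 0 := by
    have h : n₂ * (k₂ + 1) = n₂ * (k₂ - k₁) + 2 * (n₂ * m) := by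
      rw [mul_left_comm, ← hm, ← mul_add]
      congr 1
      omega
    omega
  obtain ⟨hI, hII⟩ := IoT.regime_iff (n₂ := n₂) hk hn₁
  refine ⟨hI, hII, fun hlt => ?_, fun heq => ?_⟩
  · obtain ⟨h0, h1, h2, h3⟩ := IoT.strategies_of_lt hcNP hcP hlt hm hm1 hn₁ (by omega) hnm hparity
    refine ⟨IoT.thresholds_strict hlt (by omega) hn₁ (by omega), h0, h1, h2, fun g hg => ?_⟩
    have hsd := hg.isSD hcNP
    rcases h3 g hg with h | h | h <;> rw [h] at hsd
    exacts [Or.inl hsd, Or.inr (Or.inl hsd), Or.inr (Or.inr hsd)]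
  · subst heq
    have hn₂' : 1 ≤ n₂ := by omega
    obtain ⟨hT, h0, h1, h2⟩ := IoT.strategies_of_eq hcNP hcP hm hm1 hn₁ hn₂' hnm
    refine ⟨?_, hT, h0, h1, fun g hg => ?_, fun h g hg hopt => ?_⟩
    · rw [sub_self, mul_zero, sub_zero, div_self (by positivity)]
      exact_mod_cast hn₂'
    · have hsd := hg.isSD hcNP
      rcases h2 g hg with h | h <;> rw [h] at hsd
      exacts [Or.inl hsd, Or.inr hsd]
    -- For `n₂ ≥ 2` and `n₁ ≥ 1`, `n₂ - 1` is neither 0 nor `n₁ + n₂ - 1`.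
    · have := hg.2.1
      rcases h2 g hopt with h' | h' <;> omega
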